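/- **Setting.** Let $T:[0,1]\to\mathbb R$ be bounded and Borel measurable with $\lim_{u\downarrow0}T(u)=C\in\mathbb R$ and $C\neq\int_0^1T(u)\,du$. For $\vartheta\in\mathbb R$ let $H_\vartheta$ be the distribution on $[0,1]$ with Lebesgue density $h_\vartheta(u)=C(\vartheta)\exp(\vartheta T(u))$, where $C(\vartheta)=1/\int_0^1\exp(\vartheta T(u))\,du$. Let $\mathbf Z=(Z_t)_{t\in[0,1]}$ be a generator, that is, a stochastic process with continuous sample paths such that, for some constant $m\ge1$, $0\le Z_t\le m$ and $E(Z_t)=1$ for all $t\in[0,1]$, whose distribution does not depend on $\vartheta$, and assume $A:=E(\inf_{t\in[0,1]}Z_t)>0$. Under the probability measure $P_\vartheta$ let $W$ have distribution $H_\vartheta$ and be independent of $\mathbf Z$, let $M<0$ be a constant, put $X_t=\max(-W/Z_t,M)$ for $t\in[0,1]$ (with $X_t=M$ if $Z_t=0$), and let $\mathbf X^{(1)},\mathbf X^{(2)},\dots$ be independent copies of $\mathbf X=(X_t)_{t\in[0,1]}$ with continuous sample paths. For $n\in\mathbb N$ and $c<0$ let $$N_{n,c}(B)=\sum_{i\le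 n}\varepsilon_{\sup_{t\in[0,1]}(X^{(i)}_t/c)}(B\cap[0,1]),\qquad B\subset\mathbb R\text{ Borel},$$ be the point process of exceedances, where $\varepsilon_x$ is the unit point mass at $x$, let $\mathcal L_\vartheta(N_{n,c})$ be its distribution under $P_\vartheta$, let $\tau(n)$ be the number of $i\le n$ with $\sup_{t\in[0,1]}(X^{(i)}_t/c)\le1$ and, whenever $\mathcal L_\vartheta(N_{n,c})\ll\mathcal L_0(N_{n,c})$, let $$L_{n,c}(\vartheta\mid0)=\log\left\{\frac{d\mathcal L_\vartheta(N_{n,c})}{d\mathcal L_0(N_{n,c})}(N_{n,c})\right\}$$ be the loglikelihood ratio. **Theorem.** Let $c_n<0$ satisfy $|c_n|\to0$ and $n|c_n|\to\infty$ as $n\to\infty$, let $\xi\in\mathbb R$, and put, with $\tau(n)$ taken at $c=c_n$, $$\vartheta_n=\frac{\xi}{(n|c_n|)^{1/2}A^{1/2}\left(C-\int_0^1T(u)\,du\right)},\qquad Z_{n1}=\frac{\tau(n)-n|c_n|A}{(n|c_n|A)^{1/2}}.$$ Then $\mathcal L_{\vartheta_n}(N_{n,c_n})$ and $\mathcal L_0(N_{n,c_n})$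 are mutually absolutely continuous for all sufficiently large $n$, $$L_{n,c_n}(\vartheta_n\mid0)=\xi Z_{n1}-\frac{\xi^2}{2}+o_{P_0}(1)\qquad(n\to\infty),$$ and $Z_{n1}$ converges in distribution to $N(0,1)$ under $P_0$. Thus the standardized number of exceedances $Z_{n1}$ is a central sequence. -/

import Mathlib

open MeasureTheory ProbabilityTheory Filter Topology unitInterval

noncomputable section

namespace GPPTesting

/-- The normalizing function `C(ϑ) = 1 / ∫₀¹ exp(ϑ T(u)) du` of the exponential family. -/
def normConst (T : ℝ → ℝ) (ϑ : ℝ) : ℝ :=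
  1 / ∫ u in Set.Icc (0 : ℝ) 1, Real.exp (ϑ * T u)

/-- The density `h_ϑ(u) = C(ϑ) exp(ϑ T(u))`, `0 ≤ u ≤ 1`. -/
def expDensity (T : ℝ → ℝ) (ϑ u : ℝ) : ℝ :=
  normConst T ϑ * Real.exp (ϑ * T u)

/-- The distribution `H_ϑ` on `[0,1]` with Lebesgue density `h_ϑ`. Only the values of `T` on
`[0,1]` matter. -/
def expFamily (T : ℝ → ℝ) (ϑ : ℝ) : Measure ℝ :=
  (volume.restrict (Set.Icc (0 : ℝ) 1)).withDensity fun u => ENNReal.ofReal (expDensity T ϑ u)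

/-- A generator: a stochastic process `Z` on `[0,1]` with continuous paths such that, for some
constant `m ≥ 1`, almost surely `0 ≤ Z_t ≤ m` for all `t`, and `E(Z_t) = 1` for all `t`.
Processes are maps into the product space `[0,1] → ℝ` with its product σ-field. -/
structure IsGenerator {Ω : Type*} [MeasurableSpace Ω] (μ : Measure Ω) (Z : Ω → I → ℝ) :
    Prop where
  measurable : Measurable Z
  continuous : ∀ ω, Continuous (Z ω)
  bounded : ∃ m : ℝ, 1 ≤ m ∧ ∀ᵐ ω ∂μ, ∀ t, 0 ≤ Z ω t ∧ Z ω t ≤ m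
  mean_one : ∀ t, ∫ ω, Z ω t ∂μ = 1

/-- The path `t ↦ max (-w / z_t, M)`. At a zero of `z`, `-w / z_t` is read as `-∞`
(for `w > 0`), so that the value is `M`. -/
def gppPath (M w : ℝ) (z : I → ℝ) : I → ℝ :=
  fun t => if z t = 0 then M else max (-(w / z t)) M

/-- The statistical model. Under the parameter `ϑ` the underlying probability measure is `P ϑ`;
`W` has distribution `H_ϑ` and is independent of the generator `Z`, whose distribution does not
depend on `ϑ`; `X 0, X 1, …` are independent copies, with continuous paths,
of the process `max (-W / Z_t, M)`. -/
structure IsExpModel {Ω : Type*} [MeasurableSpace Ω] (T : ℝ → ℝ) (M : ℝ) (P : ℝ → Measure Ω)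
    (W : Ω → ℝ) (Z : Ω → I → ℝ) (X : ℕ → Ω → I → ℝ) : Prop where
  measurable_W : Measurable W
  law_W : ∀ ϑ, (P ϑ).map W = expFamily T ϑ
  generator : ∀ ϑ, IsGenerator (P ϑ) Z
  law_Z : ∀ ϑ, (P ϑ).map Z = (P 0).map Z
  indep_W_Z : ∀ ϑ, IndepFun W Z (P ϑ)
  measurable_X : ∀ i, Measurable (X i)
  continuous_X : ∀ ϑ i, ∀ᵐ ω ∂P ϑ, Continuous (X i ω)
  copies : ∀ ϑ i, IdentDistrib (X i) (fun ω => gppPath M (W ω) (Z ω)) (P ϑ) (P ϑ)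
  indep : ∀ ϑ, iIndepFun X (P ϑ)

/-- `sup_{t ∈ [0,1]} (x_t / c)`. -/
def supRatio (c : ℝ) (x : I → ℝ) : ℝ := ⨆ t, x t / c

/-- The point process of exceedances `N_{n,c}(B) = ∑_{i ≤ n} ε_{sup_t (X^{(i)}_t / c)}(B ∩ [0,1])`,
a random measure on `ℝ`. -/
def pointProcess {Ω : Type*} (X : ℕ → Ω → I → ℝ) (n : ℕ) (c : ℝ) (ω : Ω) : Measure ℝ :=
  ∑ i ∈ Finset.range n, (Measure.dirac (supRatio c (X i ω))).restrict (Set.Icc 0 1)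

open Classical in
/-- The number `τ(n)` of exceedances: the number of those `sup_t (X^{(i)}_t / c)`, among the
first `n`, that are at most `1`. -/
def numExceed {Ω : Type*} (X : ℕ → Ω → I → ℝ) (n : ℕ) (c : ℝ) (ω : Ω) : ℕ :=
  ((Finset.range n).filter fun i => supRatio c (X i ω) ≤ 1).card

/-- The distribution of `N_{n,c}` under `ϑ`, on the space of measures on `ℝ` with the σ-field
generated by the evaluations `μ ↦ μ B`. -/
def lawN {Ω : Type*} [MeasurableSpace Ω] (P : ℝ → Measure Ω) (X : ℕ → Ω → I → ℝ)
    (n : ℕ) (c ϑ : ℝ) : Measure (Measure ℝ) :=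
  (P ϑ).map (pointProcess X n c)

/-- The loglikelihood ratio `L_{n,c}(ϑ | 0)`: the logarithm of the Radon-Nikodym density of the
distribution of `N_{n,c}` under `ϑ` with respect to that under `0`, evaluated at `N_{n,c}`. -/
def logLik {Ω : Type*} [MeasurableSpace Ω] (P : ℝ → Measure Ω) (X : ℕ → Ω → I → ℝ)
    (n : ℕ) (c ϑ : ℝ) (ω : Ω) : ℝ :=
  Real.log ((lawN P X n c ϑ).rnDeriv (lawN P X n c 0) (pointProcess X n c ω)).toReal

/-- `A = E(inf_{t ∈ [0,1]} Z_t)`. -/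
def meanInf {Ω : Type*} [MeasurableSpace Ω] (μ : Measure Ω) (Z : Ω → I → ℝ) : ℝ :=
  ∫ ω, ⨅ t, Z ω t ∂μ

/-- `Z_{n1} = (τ(n) - n|c|A) / (n|c|A)^{1/2}`, the standardized number of exceedances. -/
def stdNumExceed {Ω : Type*} (X : ℕ → Ω → I → ℝ) (A : ℝ) (n : ℕ) (c : ℝ) (ω : Ω) : ℝ :=
  ((numExceed X n c ω : ℝ) - n * |c| * A) / √(n * |c| * A)

/-- The alternative `ϑ_n(ξ) = ξ / ((n|c_n|)^{1/2} A^{1/2} (C - ∫₀¹ T(u) du))`. -/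
def altParam (T : ℝ → ℝ) (C A ξ : ℝ) (c : ℕ → ℝ) (n : ℕ) : ℝ :=
  ξ / (√(n * |c n|) * √A * (C - ∫ u in Set.Icc (0 : ℝ) 1, T u))

end GPPTesting

end

/-! Put Y = inf_t Z_t and p = |c|A, so that p → 0 and np → ∞. Once M < c, the event sup_t X_t/c ≤ b
with b ∈ [0,1] is, up to null sets and equality in law, W ≤ b|c|Y. An observation visible in [0,1]
therefore behaves like W/(|c|Y). If moreover |c|m ≤ 1, with m a bound for Y, this variable has
density |c|E(Y h_ϑ(|c|Yv)) at v ∈ [0,1] (`IsExpModel.map_truncUnit_countSup`). At ϑ = 0 the density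
is the constant p. As c → 0 and ϑ → 0 only values of h_ϑ near the origin enter, where h_ϑ = 1 + ϑ(C
- ∫T) + o(ϑ) uniformly (`exists_abs_expDensity_sub_le`). The likelihood ratio q of one observation
is thus 1 + a + o(a) on [0,1], with a = ξ/√(np).

Everything off [0,1] is collapsed to a single atom, where total mass one forces q = 1 - pa + o(pa).
The product of the q(V_i) over a truncated sample is a function of the point measure alone. Hence it
is the likelihood ratio of the point processes, and positivity of q gives mutual absolute continuity
(`absolutelyContinuous_and_log_rnDeriv_pointProcess`).

With η = q - 1 and ψ = a(1_{[0,1]} - p) one has nE(η - ψ)² → 0 and nEψ² → ξ². Expanding log(1 + η)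
to second order then gives Σψ - ξ²/2 + o(1) (`tendstoInMeasure_sum_log_one_add`), and Σψ = ξ Z_{n1}.
To this order the positions of the points in [0,1] carry no information and only their number
counts. The limit law follows from a central limit theorem for the same summands with ξ = 1
(`tendsto_charFun_sum_of_bound`). -/

noncomputable section

namespace GPPTesting

/-! ### Convergence to zero in probability, by moment bounds. -/

section ConvergenceInMeasure

variable {Ω : Type*} [MeasurableSpace Ω] {μ : Measure Ω} [IsProbabilityMeasure μ]

lemma tendstoInMeasure_zero_iff {f : ℕ → Ω → ℝ} :
    TendstoInMeasure μ f atTop (fun _ => 0) ↔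
      ∀ ε, 0 < ε → Tendsto (fun n => μ.real {ω | ε ≤ |f n ω|}) atTop (𝓝 0) := by
  simp [tendstoInMeasure_iff_measureReal_norm]

lemma tendstoInMeasure_zero_of_integral {f g : ℕ → Ω → ℝ}
    (hfg : ∀ᶠ n in atTop, ∀ ω, |f n ω| ≤ g n ω) (hg : ∀ᶠ n in atTop, Integrable (g n) μ)
    (hlim : Tendsto (fun n => ∫ ω, g n ω ∂μ) atTop (𝓝 0)) :
    TendstoInMeasure μ f atTop (fun _ => 0) := by
  rw [tendstoInMeasure_zero_iff]
  intro ε hε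
  have hlim' : Tendsto (fun n => (∫ ω, g n ω ∂μ) / ε) atTop (𝓝 0) := by
    simpa using hlim.div_const ε
  refine squeeze_zero' (.of_forall fun _ => measureReal_nonneg) ?_ hlim'
  filter_upwards [hfg, hg] with n h1 h2
  rw [le_div_iff₀ hε, mul_comm]
  refine le_trans ?_ (mul_meas_ge_le_integral_of_nonneg
    (.of_forall fun ω => (abs_nonneg _).trans (h1 ω)) h2 ε)
  refine mul_le_mul_of_nonneg_left (measureReal_mono fun ω hω => ?_) hε.le
  exact le_trans hω (h1 ω)

lemma tendstoInMeasure_zero_of_integral_sq {f : ℕ → Ω → ℝ}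
    (hf : ∀ᶠ n in atTop, Integrable (fun ω => f n ω ^ 2) μ)
    (hlim : Tendsto (fun n => ∫ ω, f n ω ^ 2 ∂μ) atTop (𝓝 0)) :
    TendstoInMeasure μ f atTop (fun _ => 0) := by
  have h := tendstoInMeasure_zero_of_integral (μ := μ) (f := fun n ω => f n ω ^ 2)
    (.of_forall fun n ω => (abs_of_nonneg (sq_nonneg (f n ω))).le) hf hlim
  rw [tendstoInMeasure_zero_iff] at h ⊢
  intro ε hε
  refine (h (ε ^ 2) (by positivity)).congr fun n => ?_
  congr 1
  ext ω
  simp only [Set.mem_ofPred_eq, abs_pow]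
  exact pow_le_pow_iff_left₀ hε.le (abs_nonneg _) two_ne_zero

lemma tendstoInMeasure_zero_add {f g : ℕ → Ω → ℝ}
    (hf : TendstoInMeasure μ f atTop (fun _ => 0)) (hg : TendstoInMeasure μ g atTop (fun _ => 0)) :
    TendstoInMeasure μ (fun n ω => f n ω + g n ω) atTop (fun _ => 0) := by
  rw [tendstoInMeasure_zero_iff] at *
  intro ε hε
  have h := (hf (ε / 2) (by positivity)).add (hg (ε / 2) (by positivity))
  rw [add_zero] at h
  refine squeeze_zero (fun _ => measureReal_nonneg) (fun n => ?_) h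
  refine (measureReal_mono fun ω hω => ?_).trans (measureReal_union_le _ _)
  simp only [Set.mem_ofPred_eq, Set.mem_union] at hω ⊢
  by_contra! hcon
  linarith [abs_add_le (f n ω) (g n ω)]

lemma tendstoInMeasure_zero_const_mul {f : ℕ → Ω → ℝ} (a : ℝ)
    (hf : TendstoInMeasure μ f atTop (fun _ => 0)) :
    TendstoInMeasure μ (fun n ω => a * f n ω) atTop (fun _ => 0) := by
  rw [tendstoInMeasure_zero_iff] at *
  intro ε hε
  refine squeeze_zero (fun _ => measureReal_nonneg) (fun n => ?_) (hf (ε / (|a| + 1)) (by positivity))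
  refine measureReal_mono fun ω hω => ?_
  simp only [Set.mem_ofPred_eq, abs_mul] at hω ⊢
  rw [div_le_iff₀ (by positivity)]
  nlinarith [abs_nonneg (f n ω), abs_nonneg a]

lemma tendstoInMeasure_zero_of_tendsto {a : ℕ → ℝ} (ha : Tendsto a atTop (𝓝 0)) :
    TendstoInMeasure μ (fun n (_ : Ω) => a n) atTop (fun _ => 0) := by
  refine tendstoInMeasure_zero_of_integral (g := fun n _ => |a n|) (.of_forall fun _ _ => le_rfl)
    (.of_forall fun _ => integrable_const _) ?_
  simpa using ha.abs

end ConvergenceInMeasure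

/-! ### Moments of sums of independent, identically distributed terms. -/

lemma abs_sum_comp_le {Ω : Type*} {V : ℕ → Ω → ℝ} {f : ℝ → ℝ} {K : ℝ} (hK : ∀ v, |f v| ≤ K) (n : ℕ) (ω : Ω) :
    |∑ i ∈ Finset.range n, f (V i ω)| ≤ n * K := by
  refine (Finset.abs_sum_le_sum_abs _ _).trans ?_
  refine (Finset.sum_le_sum fun i _ => hK _).trans ?_
  simp

section Sums

variable {Ω : Type*} [MeasurableSpace Ω] {μ : Measure Ω} [IsProbabilityMeasure μ]
  {V : ℕ → Ω → ℝ} {Q : Measure ℝ}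

lemma integrable_of_measurable_of_bound {α : Type*} [MeasurableSpace α] {ν : Measure α}
    [IsFiniteMeasure ν] {f : α → ℝ} (hf : Measurable f) {K : ℝ} (hK : ∀ v, |f v| ≤ K) :
    Integrable f ν :=
  Integrable.of_bound hf.aestronglyMeasurable K (.of_forall hK)

lemma integral_sum_comp (hV : ∀ i, Measurable (V i)) (hQ : ∀ i, μ.map (V i) = Q)
    {f : ℝ → ℝ} (hf : Measurable f) {K : ℝ} (hK : ∀ v, |f v| ≤ K) (n : ℕ) :
    ∫ ω, ∑ i ∈ Finset.range n, f (V i ω) ∂μ = n * ∫ v, f v ∂Q := by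
  have hint (i : ℕ) : Integrable (fun ω => f (V i ω)) μ :=
    integrable_of_measurable_of_bound (hf.comp (hV i)) fun ω => hK _
  rw [integral_finsetSum _ fun i _ => hint i]
  have h (i : ℕ) : ∫ ω, f (V i ω) ∂μ = ∫ v, f v ∂Q := by
    rw [← hQ i, integral_map (hV i).aemeasurable hf.aestronglyMeasurable]
  simp [h]

lemma integrable_sq_sum_comp_sub (hV : ∀ i, Measurable (V i))
    {f : ℝ → ℝ} (hf : Measurable f) {K : ℝ} (hK : ∀ v, |f v| ≤ K) (n : ℕ) (a : ℝ) :
    Integrable (fun ω => (∑ i ∈ Finset.range n, f (V i ω) - a) ^ 2) μ := by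
  refine integrable_of_measurable_of_bound (K := (n * K + |a|) ^ 2)
    (((Finset.measurable_sum _ fun i _ => hf.comp (hV i)).sub_const _).pow_const 2) fun ω => ?_
  rw [abs_pow]
  refine pow_le_pow_left₀ (abs_nonneg _) ((abs_sub _ _).trans ?_) 2
  gcongr
  exact abs_sum_comp_le hK n ω

/-- Variances add by pairwise independence, and each is at most the second moment. -/
lemma integral_sq_sum_comp_sub_le (hV : ∀ i, Measurable (V i)) (hind : iIndepFun V μ)
    (hQ : ∀ i, μ.map (V i) = Q)
    {f : ℝ → ℝ} (hf : Measurable f) {K : ℝ} (hK : ∀ v, |f v| ≤ K) (n : ℕ) :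
    ∫ ω, (∑ i ∈ Finset.range n, f (V i ω) - n * ∫ v, f v ∂Q) ^ 2 ∂μ ≤ n * ∫ v, f v ^ 2 ∂Q := by
  have hmem (i : ℕ) : MemLp (fun ω => f (V i ω)) 2 μ :=
    MemLp.of_bound (hf.comp (hV i)).aestronglyMeasurable K (.of_forall fun ω => hK _)
  have hvar := IndepFun.variance_sum (μ := μ) (X := fun i ω => f (V i ω)) (s := Finset.range n)
    (fun i _ => hmem i) (fun i _ j _ hij => (hind.indepFun hij).comp hf hf)
  have hmeas : AEMeasurable (∑ i ∈ Finset.range n, fun ω => f (V i ω)) μ :=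
    Finset.aemeasurable_sum _ fun i _ => (hf.comp (hV i)).aemeasurable
  rw [variance_eq_integral hmeas] at hvar
  simp only [Finset.sum_apply] at hvar
  rw [integral_sum_comp hV hQ hf hK] at hvar
  rw [hvar]
  have h (i : ℕ) : variance (fun ω => f (V i ω)) μ ≤ ∫ v, f v ^ 2 ∂Q := by
    refine (variance_le_expectation_sq (hf.comp (hV i)).aestronglyMeasurable).trans_eq ?_
    rw [← hQ i, integral_map (hV i).aemeasurable (hf.pow_const 2).aestronglyMeasurable]
    rfl
  refine (Finset.sum_le_sum fun i _ => h i).trans ?_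
  simp

end Sums

/-! ### Quadratic expansion of loglikelihoods for triangular arrays. -/

/-- The Taylor remainder is at most |x|³/(1 - |x|), and 1 - |x| ≥ 1/2. -/
lemma abs_log_one_add_sub_le {x : ℝ} (hx : |x| ≤ 1 / 2) :
    |Real.log (1 + x) - x + x ^ 2 / 2| ≤ 2 * |x| * x ^ 2 := by
  have h := Real.abs_log_sub_add_sum_range_le (x := -x) (by rw [abs_neg]; linarith) 2
  simp only [Finset.sum_range_succ, Finset.range_zero, Finset.sum_empty, abs_neg] at h
  norm_num at h
  have e : -x + x ^ 2 / 2 + Real.log (1 + x) = Real.log (1 + x) - x + x ^ 2 / 2 := by ring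
  rw [e] at h
  refine h.trans ?_
  rw [div_le_iff₀ (by linarith), ← sq_abs x]
  nlinarith [pow_nonneg (abs_nonneg x) 3]

/-- Quadratic expansion of the loglikelihood ratio of a triangular array of rowwise independent and
identically distributed observations with likelihood ratios `1 + η n`, when `η n` is approximated
in mean square by `ψ n`. -/
theorem tendstoInMeasure_sum_log_one_add {Ω : Type*} [MeasurableSpace Ω] {μ : Measure Ω}
    [IsProbabilityMeasure μ] {V : ℕ → ℕ → Ω → ℝ} {Q : ℕ → Measure ℝ}
    [∀ n, IsProbabilityMeasure (Q n)]
    (hV : ∀ n i, Measurable (V n i)) (hind : ∀ n, iIndepFun (V n) μ)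
    (hQ : ∀ n i, μ.map (V n i) = Q n)
    {η ψ : ℕ → ℝ → ℝ} (hη : ∀ n, Measurable (η n)) (hψ : ∀ n, Measurable (ψ n))
    {s : ℕ → ℝ} (hs : Tendsto s atTop (𝓝 0))
    (hηs : ∀ᶠ n in atTop, ∀ v, |η n v| ≤ s n) (hψs : ∀ᶠ n in atTop, ∀ v, |ψ n v| ≤ s n)
    (hη0 : ∀ᶠ n in atTop, ∫ v, η n v ∂Q n = 0) (hψ0 : ∀ᶠ n in atTop, ∫ v, ψ n v ∂Q n = 0)
    (hd : Tendsto (fun n : ℕ => n * ∫ v, (η n v - ψ n v) ^ 2 ∂Q n) atTop (𝓝 0))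
    {a : ℝ} (ha : Tendsto (fun n : ℕ => n * ∫ v, ψ n v ^ 2 ∂Q n) atTop (𝓝 a)) :
    TendstoInMeasure μ (fun n ω => ∑ i ∈ Finset.range n, Real.log (1 + η n (V n i ω)) -
      (∑ i ∈ Finset.range n, ψ n (V n i ω) - a / 2)) atTop (fun _ => 0) := by
  have hbd : ∀ᶠ n in atTop, ∀ v, |η n v - ψ n v| ≤ 2 * s n := by
    filter_upwards [hηs, hψs] with n h1 h2 v
    linarith [abs_sub (η n v) (ψ n v), h1 v, h2 v]
  have hψ2 : ∀ᶠ n in atTop, ∀ v, |ψ n v ^ 2| ≤ s n ^ 2 := by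
    filter_upwards [hψs] with n h v
    rw [abs_pow]; exact pow_le_pow_left₀ (abs_nonneg _) (h v) 2
  have hη2 : ∀ᶠ n in atTop, ∀ v, |η n v ^ 2| ≤ s n ^ 2 := by
    filter_upwards [hηs] with n h v
    rw [abs_pow]; exact pow_le_pow_left₀ (abs_nonneg _) (h v) 2
  have hd2 : ∀ᶠ n in atTop, ∀ v, |(η n v - ψ n v) ^ 2| ≤ (2 * s n) ^ 2 := by
    filter_upwards [hbd] with n h v
    rw [abs_pow]; exact pow_le_pow_left₀ (abs_nonneg _) (h v) 2
  -- linear term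
  have h1 : TendstoInMeasure μ (fun n ω => ∑ i ∈ Finset.range n, (η n (V n i ω) - ψ n (V n i ω)))
      atTop (fun _ => 0) := by
    refine tendstoInMeasure_zero_of_integral_sq ?_ ?_
    · filter_upwards [hbd] with n h
      simpa using integrable_sq_sum_comp_sub (hV n) ((hη n).sub (hψ n)) h n 0
    · refine squeeze_zero' (.of_forall fun n => integral_nonneg fun _ => sq_nonneg _) ?_ hd
      filter_upwards [hbd, hη0, hψ0, hηs, hψs] with n h e1 e2 h3 h4
      have e3 : ∫ v, (η n - ψ n) v ∂Q n = 0 := by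
        rw [integral_sub' (integrable_of_measurable_of_bound (hη n) h3)
          (integrable_of_measurable_of_bound (hψ n) h4), e1, e2, sub_zero]
      have := integral_sq_sum_comp_sub_le (hV n) (hind n) (hQ n) ((hη n).sub (hψ n)) h n
      rw [e3] at this
      simpa using this
  -- difference of the quadratic terms
  have hnn (n : ℕ) : 0 ≤ (n : ℝ) * ∫ v, ψ n v ^ 2 ∂Q n :=
    mul_nonneg n.cast_nonneg (integral_nonneg fun _ => sq_nonneg _)
  have h2 : TendstoInMeasure μ
      (fun n ω => ∑ i ∈ Finset.range n, (η n (V n i ω) ^ 2 - ψ n (V n i ω) ^ 2))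
      atTop (fun _ => 0) := by
    have hmeas (n : ℕ) : Measurable fun v => |η n v ^ 2 - ψ n v ^ 2| :=
      (((hη n).pow_const 2).sub ((hψ n).pow_const 2)).abs
    have hbb : ∀ᶠ n in atTop, ∀ v, |(|η n v ^ 2 - ψ n v ^ 2|)| ≤ 2 * s n ^ 2 := by
      filter_upwards [hη2, hψ2] with n h3 h4 v
      rw [abs_abs]
      linarith [abs_sub (η n v ^ 2) (ψ n v ^ 2), h3 v, h4 v]
    refine tendstoInMeasure_zero_of_integral
      (g := fun n ω => ∑ i ∈ Finset.range n, |η n (V n i ω) ^ 2 - ψ n (V n i ω) ^ 2|)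
      (.of_forall fun n ω => Finset.abs_sum_le_sum_abs _ _) ?_ ?_
    · filter_upwards [hbb] with n h
      exact integrable_finsetSum _ fun i _ =>
        integrable_of_measurable_of_bound ((hmeas n).comp (hV n i)) fun ω => h _
    -- Write η² - ψ² = (η - ψ)² + 2(η - ψ)ψ and split the cross term by the weighted inequality
    -- 2|xy| ≤ x²/ε + εy². The first part vanishes in the limit for fixed ε, and the second is of
    -- order ε.
    · have key : ∀ ε : ℝ, 0 < ε → ∀ᶠ n : ℕ in atTop,
          n * ∫ v, |η n v ^ 2 - ψ n v ^ 2| ∂Q n ≤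
            (1 + 1 / ε) * (n * ∫ v, (η n v - ψ n v) ^ 2 ∂Q n) +
              ε * (n * ∫ v, ψ n v ^ 2 ∂Q n) := by
        intro ε hε
        filter_upwards [hbb, hψ2, hd2] with n h3 h4 h5
        have i1 : Integrable (fun v => (η n v - ψ n v) ^ 2) (Q n) :=
          integrable_of_measurable_of_bound (((hη n).sub (hψ n)).pow_const 2) h5
        have i2 : Integrable (fun v => ψ n v ^ 2) (Q n) :=
          integrable_of_measurable_of_bound ((hψ n).pow_const 2) h4
        have := integral_mono (μ := Q n) (integrable_of_measurable_of_bound (hmeas n) h3)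
          ((i1.const_mul (1 + 1 / ε)).add (i2.const_mul ε)) (fun v => by
            simp only [Pi.add_apply]
            set x := η n v
            set y := ψ n v
            have e : x ^ 2 - y ^ 2 = (x - y) ^ 2 + 2 * ((x - y) * y) := by ring
            have e2 : |2 * ((x - y) * y)| ≤ 1 / ε * (x - y) ^ 2 + ε * y ^ 2 := by
              rw [abs_le]
              have a1 : 0 ≤ 1 / ε * (x - y + ε * y) ^ 2 := by positivity
              have a2 : 0 ≤ 1 / ε * (x - y - ε * y) ^ 2 := by positivity
              have b1 : 1 / ε * (x - y + ε * y) ^ 2 =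
                1 / ε * (x - y) ^ 2 + 2 * ((x - y) * y) + ε * y ^ 2 := by field_simp; ring
              have b2 : 1 / ε * (x - y - ε * y) ^ 2 =
                1 / ε * (x - y) ^ 2 - 2 * ((x - y) * y) + ε * y ^ 2 := by field_simp; ring
              constructor <;> linarith
            rw [e]
            refine (abs_add_le _ _).trans ?_
            rw [abs_of_nonneg (sq_nonneg (x - y))]
            linarith)
        simp only [Pi.add_apply] at this
        rw [integral_add (i1.const_mul _) (i2.const_mul ε), integral_const_mul,
          integral_const_mul] at this
        have := mul_le_mul_of_nonneg_left this (Nat.cast_nonneg (α := ℝ) n)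
        linarith
      have hlim : Tendsto (fun n : ℕ => n * ∫ v, |η n v ^ 2 - ψ n v ^ 2| ∂Q n) atTop (𝓝 0) := by
        rw [Metric.tendsto_atTop']
        have ha0 : 0 ≤ a := ge_of_tendsto' ha hnn
        intro δ hδ
        -- The summand 1 covers a = 0; the choice makes εa < δ.
        have hε : 0 < δ / (2 * (a + 1)) := by positivity
        set ε := δ / (2 * (a + 1)) with hεdef
        have ht : Tendsto (fun n : ℕ => (1 + 1 / ε) * (n * ∫ v, (η n v - ψ n v) ^ 2 ∂Q n) +
            ε * (n * ∫ v, ψ n v ^ 2 ∂Q n)) atTop (𝓝 ((1 + 1 / ε) * 0 + ε * a)) :=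
          (hd.const_mul _).add (ha.const_mul _)
        have hlt : (1 + 1 / ε) * 0 + ε * a < δ := by
          rw [mul_zero, zero_add, hεdef, div_mul_eq_mul_div, div_lt_iff₀ (by positivity)]
          nlinarith
        obtain ⟨N, hN⟩ := eventually_atTop.1 ((key ε hε).and (ht.eventually (gt_mem_nhds hlt)))
        refine ⟨N, fun n hn => ?_⟩
        obtain ⟨g1, g2⟩ := hN n hn.le
        rw [Real.dist_eq, sub_zero, abs_of_nonneg]
        · linarith
        · exact mul_nonneg n.cast_nonneg (integral_nonneg fun _ => abs_nonneg _)
      refine hlim.congr' ?_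
      filter_upwards [hbb] with n h
      exact (integral_sum_comp (hV n) (hQ n) (hmeas n) h n).symm
  -- the quadratic term
  have h3 : TendstoInMeasure μ (fun n ω => ∑ i ∈ Finset.range n, ψ n (V n i ω) ^ 2 -
      n * ∫ v, ψ n v ^ 2 ∂Q n) atTop (fun _ => 0) := by
    refine tendstoInMeasure_zero_of_integral_sq ?_ ?_
    · filter_upwards [hψ2] with n h
      exact integrable_sq_sum_comp_sub (hV n) ((hψ n).pow_const 2) h n _
    -- A law of large numbers for ψ²: since ψ⁴ ≤ s²ψ², the variance of the sum is at most s² · n∫ψ²,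
    -- which tends to 0.
    · have ht : Tendsto (fun n : ℕ => s n ^ 2 * (n * ∫ v, ψ n v ^ 2 ∂Q n)) atTop (𝓝 0) := by
        simpa using (hs.pow 2).mul ha
      refine squeeze_zero' (.of_forall fun n => integral_nonneg fun _ => sq_nonneg _) ?_ ht
      filter_upwards [hψ2] with n h
      refine (integral_sq_sum_comp_sub_le (hV n) (hind n) (hQ n) ((hψ n).pow_const 2) h n).trans ?_
      have hm := integral_mono (μ := Q n)
        (integrable_of_measurable_of_bound (((hψ n).pow_const 2).pow_const 2)
          (K := (s n ^ 2) ^ 2) fun v => by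
            rw [abs_pow]; exact pow_le_pow_left₀ (abs_nonneg _) (h v) 2)
        ((integrable_of_measurable_of_bound ((hψ n).pow_const 2) h).const_mul (s n ^ 2))
        (fun v => by
          have := h v
          rw [abs_of_nonneg (sq_nonneg _)] at this
          change (ψ n v ^ 2) ^ 2 ≤ s n ^ 2 * ψ n v ^ 2
          rw [sq (ψ n v ^ 2)]
          exact mul_le_mul_of_nonneg_right this (sq_nonneg _))
      rw [integral_const_mul] at hm
      have := mul_le_mul_of_nonneg_left hm (Nat.cast_nonneg (α := ℝ) n)
      linarith
  have h4 : TendstoInMeasure μ (fun n (_ : Ω) => n * ∫ v, ψ n v ^ 2 ∂Q n - a) atTop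
      (fun _ => 0) := by
    apply tendstoInMeasure_zero_of_tendsto
    simpa using ha.sub_const a
  -- the remainder
  have h5 : TendstoInMeasure μ (fun n ω => ∑ i ∈ Finset.range n,
      (Real.log (1 + η n (V n i ω)) - η n (V n i ω) + η n (V n i ω) ^ 2 / 2)) atTop
      (fun _ => 0) := by
    refine tendstoInMeasure_zero_of_integral
      (g := fun n ω => ∑ i ∈ Finset.range n, 2 * s n * η n (V n i ω) ^ 2) ?_ ?_ ?_
    · filter_upwards [hηs, hs.eventually (gt_mem_nhds (by norm_num : (0 : ℝ) < 1 / 2))]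
        with n h hs2 ω
      refine (Finset.abs_sum_le_sum_abs _ _).trans (Finset.sum_le_sum fun i _ => ?_)
      refine (abs_log_one_add_sub_le ((h _).trans hs2.le)).trans ?_
      have := h (V n i ω)
      gcongr
    · filter_upwards [hη2] with n h
      exact integrable_finsetSum _ fun i _ => (integrable_of_measurable_of_bound
        (((hη n).pow_const 2).comp (hV n i)) fun ω => h _).const_mul _
    · have ht : Tendsto (fun n : ℕ => 2 * s n * (2 * (n * ∫ v, (η n v - ψ n v) ^ 2 ∂Q n) +
          2 * (n * ∫ v, ψ n v ^ 2 ∂Q n))) atTop (𝓝 (2 * 0 * (2 * 0 + 2 * a))) :=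
        (hs.const_mul 2).mul ((hd.const_mul 2).add (ha.const_mul 2))
      rw [mul_zero, zero_mul] at ht
      refine squeeze_zero' ?_ ?_ ht
      · filter_upwards [hηs] with n h
        have : 0 ≤ s n := (abs_nonneg _).trans (h 0)
        exact integral_nonneg fun ω => Finset.sum_nonneg fun i _ => by positivity
      · filter_upwards [hη2, hψ2, hd2, hηs] with n h6 h7 h8 h9
        have hs0 : 0 ≤ s n := (abs_nonneg _).trans (h9 0)
        simp_rw [← Finset.mul_sum]
        rw [integral_const_mul, integral_sum_comp (hV n) (hQ n) ((hη n).pow_const 2) h6 n]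
        refine mul_le_mul_of_nonneg_left ?_ (by positivity)
        have i1 : Integrable (fun v => (η n v - ψ n v) ^ 2) (Q n) :=
          integrable_of_measurable_of_bound (((hη n).sub (hψ n)).pow_const 2) h8
        have i2 : Integrable (fun v => ψ n v ^ 2) (Q n) :=
          integrable_of_measurable_of_bound ((hψ n).pow_const 2) h7
        have := integral_mono (μ := Q n)
          (integrable_of_measurable_of_bound ((hη n).pow_const 2) h6)
          ((i1.const_mul 2).add (i2.const_mul 2)) (fun v => by
            simp only [Pi.add_apply]
            nlinarith [sq_nonneg (η n v - 2 * ψ n v)])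
        simp only [Pi.add_apply] at this
        rw [integral_add (i1.const_mul _) (i2.const_mul _), integral_const_mul,
          integral_const_mul] at this
        have := mul_le_mul_of_nonneg_left this (Nat.cast_nonneg (α := ℝ) n)
        linarith
  -- The error is Σ(η - ψ), plus the Taylor remainder, minus half of Σ(η² - ψ²) + (Σψ² - n∫ψ²) +
  -- (n∫ψ² - a).
  have hfin := tendstoInMeasure_zero_add (tendstoInMeasure_zero_add h1 h5)
    (tendstoInMeasure_zero_const_mul (-1 / 2)
      (tendstoInMeasure_zero_add h2 (tendstoInMeasure_zero_add h3 h4)))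
  refine hfin.congr_left fun n => .of_forall fun ω => ?_
  simp only [Finset.sum_sub_distrib, Finset.sum_add_distrib, ← Finset.sum_div]
  ring

/-! ### Central limit theorem for triangular arrays. -/

lemma norm_exp_mul_I_sub_le {x : ℝ} (hx : |x| ≤ 1) :
    ‖Complex.exp (x * Complex.I) - (1 + x * Complex.I - x ^ 2 / 2)‖ ≤ |x| * x ^ 2 := by
  have hn : ‖(x : ℂ) * Complex.I‖ = |x| := by simp
  have h := Complex.exp_bound (x := x * Complex.I) (by rw [hn]; exact hx) (n := 3) (by norm_num)
  simp only [Finset.sum_range_succ, Finset.range_zero, Finset.sum_empty, hn] at h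
  have e : (0 : ℂ) + (x * Complex.I) ^ 0 / (Nat.factorial 0) +
      (x * Complex.I) ^ 1 / (Nat.factorial 1) + (x * Complex.I) ^ 2 / (Nat.factorial 2) =
      1 + x * Complex.I - x ^ 2 / 2 := by
    simp [mul_pow, Nat.factorial]; ring
  rw [e] at h
  refine h.trans ?_
  have h3 : |x| ^ 3 = |x| * x ^ 2 := by rw [pow_succ', sq_abs]
  rw [h3]
  refine mul_le_of_le_one_right (by positivity) ?_
  norm_num [Nat.factorial]

/-- The central limit theorem, in terms of characteristic functions, for triangular arrays of
rowwise independent and identically distributed, uniformly asymptotically negligible summands. -/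
theorem tendsto_charFun_sum_of_bound {Ω : Type*} [MeasurableSpace Ω] {μ : Measure Ω}
    [IsProbabilityMeasure μ] {V : ℕ → ℕ → Ω → ℝ} {Q : ℕ → Measure ℝ}
    [∀ n, IsProbabilityMeasure (Q n)]
    (hV : ∀ n i, Measurable (V n i)) (hind : ∀ n, iIndepFun (V n) μ)
    (hQ : ∀ n i, μ.map (V n i) = Q n)
    {ψ : ℕ → ℝ → ℝ} (hψ : ∀ n, Measurable (ψ n))
    {s : ℕ → ℝ} (hs : Tendsto s atTop (𝓝 0)) (hψs : ∀ᶠ n in atTop, ∀ v, |ψ n v| ≤ s n)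
    (hψ0 : ∀ᶠ n in atTop, ∫ v, ψ n v ∂Q n = 0)
    (ha : Tendsto (fun n : ℕ => n * ∫ v, ψ n v ^ 2 ∂Q n) atTop (𝓝 1)) (t : ℝ) :
    Tendsto (fun n => charFun (μ.map fun ω => ∑ i ∈ Finset.range n, ψ n (V n i ω)) t) atTop
      (𝓝 (Complex.exp (-t ^ 2 / 2))) := by
  have hcf (n : ℕ) : charFun (μ.map fun ω => ∑ i ∈ Finset.range n, ψ n (V n i ω)) t =
      (1 + (∫ v, Complex.exp (t * ψ n v * Complex.I) ∂Q n - 1)) ^ n := by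
    have hi : iIndepFun (fun i ω => ψ n (V n i ω)) μ := (hind n).comp _ fun _ => hψ n
    have hm (i : ℕ) : AEMeasurable (fun ω => ψ n (V n i ω)) μ := ((hψ n).comp (hV n i)).aemeasurable
    rw [(hi.restrict _).charFun_map_fun_finsetSum_eq_prod fun i _ => hm i]
    have (i : ℕ) : charFun (μ.map fun ω => ψ n (V n i ω)) t =
        ∫ v, Complex.exp (t * ψ n v * Complex.I) ∂Q n := by
      rw [charFun_apply_real, integral_map (hm i) (by fun_prop), ← hQ n i, integral_map (hV n i).aemeasurable]
      have := hψ n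
      exact Measurable.aestronglyMeasurable (by fun_prop)
    simp [this]
  simp_rw [hcf]
  -- By independence the characteristic function is an n-th power φ^n, so it suffices that n(φ - 1)
  -- → -t²/2. Centring removes the linear term, and the remainder `r` is of third order, at most
  -- |t|s · t²∫ψ².
  apply Complex.tendsto_one_add_pow_exp_of_tendsto
  set r : ℕ → ℂ := fun n => ∫ v, (Complex.exp (t * ψ n v * Complex.I) -
    (1 + t * ψ n v * Complex.I - (t * ψ n v) ^ 2 / 2)) ∂Q n with hr
  have hts : Tendsto (fun n => |t| * s n) atTop (𝓝 0) := by simpa using hs.const_mul |t|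
  have hts1 : ∀ᶠ n in atTop, |t| * s n ≤ 1 := (hts.eventually (gt_mem_nhds one_pos)).mono
    fun n h => h.le
  have hbound : ∀ᶠ n in atTop, ∀ v, |ψ n v ^ 2| ≤ s n ^ 2 := by
    filter_upwards [hψs] with n h v
    rw [abs_pow]; exact pow_le_pow_left₀ (abs_nonneg _) (h v) 2
  have hrlim : Tendsto (fun n : ℕ => n * r n) atTop (𝓝 0) := by
    rw [tendsto_zero_iff_norm_tendsto_zero]
    have hlim : Tendsto (fun n : ℕ => |t| * s n * t ^ 2 * (n * ∫ v, ψ n v ^ 2 ∂Q n)) atTop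
        (𝓝 0) := by simpa using (hts.mul_const (t ^ 2)).mul ha
    refine squeeze_zero' (.of_forall fun _ => norm_nonneg _) ?_ hlim
    filter_upwards [hψs, hts1, hbound] with n h1 h2 h3
    have hle : ‖r n‖ ≤ ∫ v, |t| * s n * t ^ 2 * ψ n v ^ 2 ∂Q n := by
      refine norm_integral_le_of_norm_le
        ((integrable_of_measurable_of_bound ((hψ n).pow_const 2) h3).const_mul _)
        (.of_forall fun v => ?_)
      have h4 : |t * ψ n v| ≤ |t| * s n := by
        rw [abs_mul]; exact mul_le_mul_of_nonneg_left (h1 v) (abs_nonneg _)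
      have := norm_exp_mul_I_sub_le (h4.trans h2)
      push_cast at this
      refine this.trans ?_
      rw [mul_pow, mul_assoc (|t| * s n)]
      exact mul_le_mul_of_nonneg_right h4 (by positivity)
    rw [integral_const_mul] at hle
    rw [norm_mul, Complex.norm_natCast]
    have := mul_le_mul_of_nonneg_left hle (Nat.cast_nonneg (α := ℝ) n)
    linarith
  have hmain : Tendsto (fun n : ℕ => n * r n -
      (t : ℂ) ^ 2 / 2 * ((n * ∫ v, ψ n v ^ 2 ∂Q n : ℝ) : ℂ)) atTop
      (𝓝 (0 - (t : ℂ) ^ 2 / 2 * ((1 : ℝ) : ℂ))) :=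
    hrlim.sub (((Complex.continuous_ofReal.tendsto 1).comp ha).const_mul _)
  rw [show (-(t : ℂ) ^ 2 / 2) = 0 - (t : ℂ) ^ 2 / 2 * ((1 : ℝ) : ℂ) by push_cast; ring]
  refine hmain.congr' ?_
  filter_upwards [hψs, hψ0, hbound] with n h1 h2 h3
  have i1 : Integrable (fun v => (ψ n v : ℂ)) (Q n) :=
    (integrable_of_measurable_of_bound (hψ n) h1).ofReal
  have i2 : Integrable (fun v => ((ψ n v ^ 2 : ℝ) : ℂ)) (Q n) :=
    (integrable_of_measurable_of_bound ((hψ n).pow_const 2) h3).ofReal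
  have i3 : Integrable (fun v => Complex.exp (t * ψ n v * Complex.I)) (Q n) := by
    have := hψ n
    refine Integrable.of_bound (Measurable.aestronglyMeasurable (by fun_prop)) 1
      (.of_forall fun v => ?_)
    rw [← Complex.ofReal_mul, Complex.norm_exp_ofReal_mul_I]
  have e (v : ℝ) : Complex.exp (t * ψ n v * Complex.I) -
      (1 + t * ψ n v * Complex.I - (t * ψ n v) ^ 2 / 2) =
      Complex.exp (t * ψ n v * Complex.I) -
        (1 + t * Complex.I * ψ n v - t ^ 2 / 2 * ((ψ n v ^ 2 : ℝ) : ℂ)) := by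
    push_cast; ring
  have j1 : Integrable (fun v => (1 : ℂ) + t * Complex.I * ψ n v) (Q n) :=
    (integrable_const _).add (i1.const_mul _)
  have hrn : r n = ∫ v, Complex.exp (t * ψ n v * Complex.I) ∂Q n -
      (1 - t ^ 2 / 2 * ((∫ v, ψ n v ^ 2 ∂Q n : ℝ) : ℂ)) := by
    simp only [hr, e]
    have j2 : Integrable (fun v => (t : ℂ) ^ 2 / 2 * ((ψ n v ^ 2 : ℝ) : ℂ)) (Q n) := i2.const_mul _
    have j3 : Integrable (fun v => (1 : ℂ) + t * Complex.I * ψ n v -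
        t ^ 2 / 2 * ((ψ n v ^ 2 : ℝ) : ℂ)) (Q n) := j1.sub j2
    rw [integral_sub i3 j3, integral_sub j1 j2,
      integral_add (integrable_const _) (i1.const_mul _), integral_const_mul, integral_const_mul,
      integral_complex_ofReal, integral_complex_ofReal, h2]
    simp
  rw [hrn]
  push_cast
  ring

/-! ### Likelihood ratio of truncated point processes. -/

/-- A density that factors through `F` survives the push-forward unchanged. This is sufficiency of
the point measure: passing from the sample to it loses no likelihood information. -/
lemma map_withDensity_comp {α β : Type*} [MeasurableSpace α] [MeasurableSpace β]
    {ν : Measure α} {F : α → β} (hF : Measurable F) {Φ : β → ENNReal} (hΦ : Measurable Φ) :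
    (ν.withDensity (Φ ∘ F)).map F = (ν.map F).withDensity Φ := by
  ext s hs
  rw [Measure.map_apply hF hs, withDensity_apply _ (hF hs), withDensity_apply _ hs,
    setLIntegral_map hs hΦ hF]
  rfl

lemma pi_withDensity {ι α : Type*} [Fintype ι] [MeasurableSpace α] {Q : Measure α}
    [IsProbabilityMeasure Q] {f : α → ENNReal} (hf : Measurable f)
    [IsProbabilityMeasure (Q.withDensity f)] :
    Measure.pi (fun _ : ι => Q.withDensity f) =
      (Measure.pi fun _ : ι => Q).withDensity fun v => ∏ i, f (v i) := by
  refine Measure.pi_eq fun s hs => ?_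
  have hset : MeasurableSet (Set.univ.pi s) := MeasurableSet.univ_pi hs
  rw [withDensity_apply _ hset, ← lintegral_indicator hset]
  have hm (i : ι) : Measurable ((s i).indicator f) := hf.indicator (hs i)
  have e (v : ι → α) : (Set.univ.pi s).indicator (fun v => ∏ i, f (v i)) v =
      ∏ i, (s i).indicator f (v i) := by
    by_cases hv : v ∈ Set.univ.pi s
    · rw [Set.indicator_of_mem hv]
      exact Finset.prod_congr rfl fun i _ =>
        (Set.indicator_of_mem (hv i (Set.mem_univ i)) f).symm
    · rw [Set.indicator_of_notMem hv]
      simp only [Set.mem_univ_pi, not_forall] at hv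
      obtain ⟨i, hi⟩ := hv
      exact (Finset.prod_eq_zero (Finset.mem_univ i) (Set.indicator_of_notMem hi f)).symm
  simp_rw [e]
  rw [lintegral_prod_eq_prod_lintegral_of_indepFun Finset.univ
    (fun i (v : ι → α) => (s i).indicator f (v i))
    (iIndepFun_pi fun i => (hm i).aemeasurable)
    fun i => (hm i).comp (measurable_pi_apply i)]
  refine Finset.prod_congr rfl fun i _ => ?_
  rw [← lintegral_map (hm i) (measurable_pi_apply i), (measurePreserving_eval _ i).map_eq,
    lintegral_indicator (hs i), withDensity_apply _ (hs i)]

/-- The point measure with atoms at those coordinates of `v` that lie in `[0,1]`. -/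
def unitPointMeasure {n : ℕ} (v : Fin n → ℝ) : Measure ℝ :=
  ∑ i, (Measure.dirac (v i)).restrict (Set.Icc 0 1)

lemma lintegral_unitPointMeasure {n : ℕ} (v : Fin n → ℝ) {f : ℝ → ENNReal} (hf : Measurable f) :
    ∫⁻ x, f x ∂unitPointMeasure v = ∑ i, (Set.Icc 0 1).indicator f (v i) := by
  rw [unitPointMeasure, lintegral_finsetSum_measure]
  refine Finset.sum_congr rfl fun i _ => ?_
  rw [← lintegral_indicator measurableSet_Icc,
    lintegral_dirac' _ (hf.indicator measurableSet_Icc)]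

lemma measurable_unitPointMeasure {n : ℕ} : Measurable (unitPointMeasure (n := n)) := by
  refine Measure.measurable_of_measurable_coe _ fun s hs => ?_
  have e (v : Fin n → ℝ) : unitPointMeasure v s =
      ∑ i, (Set.Icc 0 1).indicator (s.indicator fun _ => 1) (v i) := by
    rw [← lintegral_unitPointMeasure v (measurable_const.indicator hs),
      lintegral_indicator hs, setLIntegral_const, one_mul]
  simp_rw [e]
  refine Finset.measurable_sum _ fun i _ => ?_
  exact ((measurable_const.indicator hs).indicator measurableSet_Icc).comp (measurable_pi_apply i)

/-- The likelihood ratio of a point process of `n` truncated observations, as a functional of the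
point measure; `q` is the likelihood ratio of one observation and `r` its value off `[0,1]`. -/
def pointLikelihood (q : ℝ → ℝ) (r : ℝ) (n : ℕ) (ν : Measure ℝ) : ENNReal :=
  ENNReal.ofReal (Real.exp (n * Real.log r +
    ((∫⁻ x, ENNReal.ofReal (Real.log (q x) - Real.log r) ∂ν).toReal -
      (∫⁻ x, ENNReal.ofReal (-(Real.log (q x) - Real.log r)) ∂ν).toReal)))

/-- Positive and negative parts are integrated separately because the σ-field on measures makes ν ↦
∫⁻ f dν measurable for measurable f with values in [0,∞]. -/
lemma measurable_pointLikelihood {q : ℝ → ℝ} (hq : Measurable q) (r : ℝ) (n : ℕ) :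
    Measurable (pointLikelihood q r n) := by
  have hm : Measurable fun x => Real.log (q x) - Real.log r := hq.log.sub_const _
  have h1 : Measurable fun ν : Measure ℝ =>
      ∫⁻ x, ENNReal.ofReal (Real.log (q x) - Real.log r) ∂ν :=
    Measure.measurable_lintegral hm.ennreal_ofReal
  have h2 : Measurable fun ν : Measure ℝ =>
      ∫⁻ x, ENNReal.ofReal (-(Real.log (q x) - Real.log r)) ∂ν :=
    Measure.measurable_lintegral hm.neg.ennreal_ofReal
  unfold pointLikelihood
  fun_prop

/-- Points off [0,1] leave no trace in the point measure, yet each contributes exactly log r. The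
sum of log q over the sample is therefore n log r plus the integral of log q - log r, whose
integrand vanishes off [0,1]. -/
lemma pointLikelihood_unitPointMeasure {q : ℝ → ℝ} (hq : Measurable q) {r : ℝ}
    (hqpos : ∀ v, 0 < q v) (hr : ∀ v ∉ Set.Icc (0 : ℝ) 1, q v = r) {n : ℕ} (v : Fin n → ℝ) :
    pointLikelihood q r n (unitPointMeasure v) = ∏ i, ENNReal.ofReal (q (v i)) := by
  have hm : Measurable fun x => Real.log (q x) - Real.log r := hq.log.sub_const _
  have hm' : Measurable fun x => -(Real.log (q x) - Real.log r) := hm.neg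
  have key (f : ℝ → ENNReal) (hf : ∀ v ∉ Set.Icc (0 : ℝ) 1, f v = 0) :
      (Set.Icc (0 : ℝ) 1).indicator f = f := by
    rw [Set.indicator_eq_self]
    intro x hx
    by_contra hx'
    exact hx (hf x hx')
  rw [pointLikelihood, lintegral_unitPointMeasure v hm.ennreal_ofReal,
    lintegral_unitPointMeasure v hm'.ennreal_ofReal, key _ fun x hx => by simp [hr x hx],
    key _ fun x hx => by simp [hr x hx],
    ENNReal.toReal_sum (by simp), ENNReal.toReal_sum (by simp), ← Finset.sum_sub_distrib,
    ← ENNReal.ofReal_prod_of_nonneg fun i _ => (hqpos _).le]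
  congr 1
  have e (i : Fin n) : (ENNReal.ofReal (Real.log (q (v i)) - Real.log r)).toReal -
      (ENNReal.ofReal (-(Real.log (q (v i)) - Real.log r))).toReal =
        Real.log (q (v i)) - Real.log r := by
    simp only [ENNReal.toReal_ofReal']
    rcases le_total 0 (Real.log (q (v i)) - Real.log r) with h | h
    · rw [max_eq_left h, max_eq_right (by linarith), sub_zero]
    · rw [max_eq_right h, max_eq_left (by linarith)]; ring
  simp_rw [e]
  rw [Finset.sum_sub_distrib]
  simp only [Finset.sum_const, Finset.card_univ, Fintype.card_fin, nsmul_eq_mul]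
  rw [add_sub_cancel, Real.exp_sum]
  exact Finset.prod_congr rfl fun i _ => Real.exp_log (hqpos _)

/-- The likelihood ratio of the point processes of the observations falling into `[0,1]`. -/
theorem absolutelyContinuous_and_log_rnDeriv_pointProcess {Ω : Type*} [MeasurableSpace Ω]
    {μ₀ μ₁ : Measure Ω} [IsProbabilityMeasure μ₀] [IsProbabilityMeasure μ₁]
    {V : ℕ → Ω → ℝ} (hV : ∀ i, Measurable (V i))
    (hi₀ : iIndepFun V μ₀) (hi₁ : iIndepFun V μ₁)
    {Q : Measure ℝ} [IsProbabilityMeasure Q] {q : ℝ → ℝ} (hq : Measurable q)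
    (hqpos : ∀ v, 0 < q v) {r : ℝ} (hr : ∀ v ∉ Set.Icc (0 : ℝ) 1, q v = r)
    (hQ₀ : ∀ i, μ₀.map (V i) = Q)
    (hQ₁ : ∀ i, μ₁.map (V i) = Q.withDensity fun v => ENNReal.ofReal (q v))
    {n : ℕ} {N : Ω → Measure ℝ}
    (hN₀ : N =ᵐ[μ₀] fun ω => ∑ i ∈ Finset.range n, (Measure.dirac (V i ω)).restrict (Set.Icc 0 1))
    (hN₁ : N =ᵐ[μ₁] fun ω =>
      ∑ i ∈ Finset.range n, (Measure.dirac (V i ω)).restrict (Set.Icc 0 1)) :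
    (μ₁.map N ≪ μ₀.map N ∧ μ₀.map N ≪ μ₁.map N) ∧
      ∀ᵐ ω ∂μ₀, Real.log ((μ₁.map N).rnDeriv (μ₀.map N) (N ω)).toReal =
        ∑ i ∈ Finset.range n, Real.log (q (V i ω)) := by
  set U : Ω → Fin n → ℝ := fun ω i => V i ω with hU
  have hUm : Measurable U := measurable_pi_lambda _ fun i => hV i
  have hNU (ω : Ω) : (∑ i ∈ Finset.range n, (Measure.dirac (V i ω)).restrict (Set.Icc 0 1)) =
      unitPointMeasure (U ω) := by
    rw [unitPointMeasure, Finset.sum_range]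
  simp_rw [hNU] at hN₀ hN₁
  have hFU : Measurable fun ω => unitPointMeasure (U ω) := measurable_unitPointMeasure.comp hUm
  have hqm : Measurable fun v => ENNReal.ofReal (q v) := hq.ennreal_ofReal
  have hQ1p : IsProbabilityMeasure (Q.withDensity fun v => ENNReal.ofReal (q v)) := by
    rw [← hQ₁ 0]; exact Measure.isProbabilityMeasure_map (hV 0).aemeasurable
  have hlaw₀ : μ₀.map U = Measure.pi fun _ : Fin n => Q := by
    rw [iIndepFun.map_fun_eq_pi_map (f := fun (i : Fin n) => V i)
      (fun i => (hV i).aemeasurable) (hi₀.precomp Fin.val_injective)]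
    simp [hQ₀]
  have hlaw₁ : μ₁.map U = (Measure.pi fun _ : Fin n => Q).withDensity
      (pointLikelihood q r n ∘ unitPointMeasure) := by
    rw [iIndepFun.map_fun_eq_pi_map (f := fun (i : Fin n) => V i)
      (fun i => (hV i).aemeasurable) (hi₁.precomp Fin.val_injective)]
    simp_rw [hQ₁]
    rw [pi_withDensity hqm]
    congr 1
    ext v
    simp [pointLikelihood_unitPointMeasure hq hqpos hr]
  have hΦ := measurable_pointLikelihood hq r n
  have h₀ : μ₀.map N = (Measure.pi fun _ : Fin n => Q).map unitPointMeasure := by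
    rw [Measure.map_congr hN₀, ← hlaw₀, Measure.map_map measurable_unitPointMeasure hUm]
    rfl
  have h₁ : μ₁.map N = (μ₀.map N).withDensity (pointLikelihood q r n) := by
    rw [h₀, ← map_withDensity_comp measurable_unitPointMeasure hΦ, ← hlaw₁,
      Measure.map_map measurable_unitPointMeasure hUm, Measure.map_congr hN₁]
    rfl
  have hprob : IsProbabilityMeasure (μ₀.map N) := by
    rw [Measure.map_congr hN₀]; exact Measure.isProbabilityMeasure_map hFU.aemeasurable
  refine ⟨⟨?_, ?_⟩, ?_⟩
  · rw [h₁]; exact withDensity_absolutelyContinuous _ _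
  · rw [h₁]
    refine withDensity_absolutelyContinuous' hΦ.aemeasurable (.of_forall fun ν => ?_)
    simp [pointLikelihood, Real.exp_pos]
  · have hrn := Measure.rnDeriv_withDensity (μ₀.map N) hΦ
    rw [← h₁] at hrn
    -- `N` need not be measurable: it agrees almost surely with a measurable map, which is enough to
    -- pull back an almost sure identity.
    have hNae : AEMeasurable N μ₀ := ⟨_, hFU, hN₀⟩
    filter_upwards [ae_of_ae_map hNae hrn, hN₀] with ω h1 h2
    rw [h1, h2, pointLikelihood_unitPointMeasure hq hqpos hr,
      ← ENNReal.ofReal_prod_of_nonneg fun i _ => (hqpos _).le,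
      ENNReal.toReal_ofReal (Finset.prod_nonneg fun i _ => (hqpos _).le),
      Real.log_prod fun i _ => (hqpos _).ne', Finset.sum_range]

/-! ### Reduction of an exceedance to W/(|c| inf Z). -/

open Classical in
/-- Truncation of an observation: points off `[0,1]` are moved to `2`. -/
def truncUnit (v : ℝ) : ℝ := if v ∈ Set.Icc (0 : ℝ) 1 then v else 2

lemma measurable_truncUnit : Measurable truncUnit :=
  Measurable.ite measurableSet_Icc measurable_id measurable_const

lemma truncUnit_of_mem {v : ℝ} (hv : v ∈ Set.Icc (0 : ℝ) 1) : truncUnit v = v := if_pos hv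

lemma truncUnit_of_notMem {v : ℝ} (hv : v ∉ Set.Icc (0 : ℝ) 1) : truncUnit v = 2 := if_neg hv

lemma two_notMem_Icc : (2 : ℝ) ∉ Set.Icc (0 : ℝ) 1 := by norm_num

lemma truncUnit_mem_iff {v : ℝ} : truncUnit v ∈ Set.Icc (0 : ℝ) 1 ↔ v ∈ Set.Icc (0 : ℝ) 1 := by
  by_cases hv : v ∈ Set.Icc (0 : ℝ) 1
  · rw [truncUnit_of_mem hv]
  · rw [truncUnit_of_notMem hv]
    exact iff_of_false two_notMem_Icc hv

lemma dirac_truncUnit_restrict (v : ℝ) :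
    (Measure.dirac (truncUnit v)).restrict (Set.Icc 0 1) =
      (Measure.dirac v).restrict (Set.Icc 0 1) := by
  classical
  by_cases hv : v ∈ Set.Icc (0 : ℝ) 1
  · rw [truncUnit_of_mem hv]
  · rw [truncUnit_of_notMem hv, restrict_dirac' measurableSet_Icc, restrict_dirac' measurableSet_Icc,
      if_neg hv, if_neg two_notMem_Icc]

/-- The supremum of `x_t / c` over a countable dense set of `t`. -/
def countSup (c : ℝ) (x : I → ℝ) : ℝ := ⨆ k : ℕ, x (TopologicalSpace.denseSeq I k) / c

/-- The supremum over all t need not be measurable for the product σ-field, whereas independence and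
equality in law pass only through measurable functionals. The countable version agrees with it on
continuous paths. -/
lemma measurable_countSup (c : ℝ) : Measurable (countSup c) :=
  Measurable.iSup fun k => Measurable.div_const
    (f := fun x : I → ℝ => x (TopologicalSpace.denseSeq I k)) (measurable_pi_apply _) c

lemma iSup_denseSeq {f : I → ℝ} (hf : Continuous f) :
    ⨆ k : ℕ, f (TopologicalSpace.denseSeq I k) = ⨆ t, f t := by
  rw [← (TopologicalSpace.denseRange_denseSeq I).ciSup' hf]
  exact (Set.rangeFactorization_surjective.iSup_comp
    fun s : Set.range (TopologicalSpace.denseSeq I) => f s)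

lemma countSup_eq_supRatio {c : ℝ} {x : I → ℝ} (hx : Continuous x) :
    countSup c x = supRatio c x :=
  iSup_denseSeq (f := fun t => x t / c) (hx.div_const c)

/-- The infimum is needed as a measurable functional of the path, so that it inherits independence
from W and a law free of ϑ. -/
lemma exists_measurable_eq_iInf {Ω : Type*} {Z : Ω → I → ℝ} (hcont : ∀ ω, Continuous (Z ω)) :
    ∃ g : (I → ℝ) → ℝ, Measurable g ∧ ∀ ω, g (Z ω) = ⨅ t, Z ω t := by
  refine ⟨fun z => ⨅ k : ℕ, z (TopologicalSpace.denseSeq I k),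
    Measurable.iInf fun k => measurable_pi_apply _, fun ω => ?_⟩
  rw [← (TopologicalSpace.denseRange_denseSeq I).ciInf' (hcont ω)]
  exact ((Set.rangeFactorization_surjective.iInf_comp
    fun s : Set.range (TopologicalSpace.denseSeq I) => Z ω s))

section Path

variable {M w c : ℝ} {z : I → ℝ}

lemma gppPath_div_mem (hM : M < 0) (hc : c < 0) (hw : 0 < w) (hz : ∀ t, 0 ≤ z t) (t : I) :
    gppPath M w z t / c ∈ Set.Icc 0 (M / c) := by
  have h : gppPath M w z t ∈ Set.Icc M 0 := by
    unfold gppPath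
    split_ifs with h0
    · exact ⟨le_rfl, hM.le⟩
    · refine ⟨le_max_right _ _, max_le ?_ hM.le⟩
      have := div_nonneg hw.le (hz t)
      linarith
  refine ⟨div_nonneg_of_nonpos h.2 hc.le, ?_⟩
  exact div_le_div_of_nonpos_of_le hc.le h.1

lemma countSup_gppPath_nonneg (hM : M < 0) (hc : c < 0) (hw : 0 < w) (hz : ∀ t, 0 ≤ z t) :
    0 ≤ countSup c (gppPath M w z) :=
  Real.iSup_nonneg fun _ => (gppPath_div_mem hM hc hw hz _).1

/-- Since b ≤ 1 and M < c < 0, one has M < bc, so the cut-off at M never meets the bound. The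
condition at each t is then w ≤ b|c|z_t, and by continuity a dense set of t suffices. -/
lemma countSup_gppPath_le_iff (hM : M < 0) (hc : c < 0) (hMc : M < c) (hw : 0 < w)
    (hz : ∀ t, 0 ≤ z t) (hcont : Continuous z) {b : ℝ} (hb : b ∈ Set.Icc (0 : ℝ) 1) :
    countSup c (gppPath M w z) ≤ b ↔ w ≤ b * (|c| * ⨅ t, z t) := by
  have hbdd : BddAbove (Set.range fun k : ℕ =>
      gppPath M w z (TopologicalSpace.denseSeq I k) / c) := by
    refine ⟨M / c, ?_⟩
    rintro _ ⟨k, rfl⟩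
    exact (gppPath_div_mem hM hc hw hz _).2
  have hbz : BddBelow (Set.range z) := ⟨0, by rintro _ ⟨t, rfl⟩; exact hz t⟩
  have hpt (t : I) : gppPath M w z t / c ≤ b ↔ w ≤ b * (|c| * z t) := by
    have hMb : M < b * c := by nlinarith [hb.1, hb.2]
    rw [div_le_iff_of_neg hc]
    unfold gppPath
    -- At a zero of z both sides fail: the path value M lies below bc, and w > 0.
    split_ifs with h0
    · rw [h0]
      constructor
      · intro h; linarith
      · intro h; nlinarith
    · have hzt : 0 < z t := lt_of_le_of_ne (hz t) (Ne.symm h0)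
      have : b * c ≤ -(w / z t) ↔ w ≤ b * (|c| * z t) := by
        rw [abs_of_neg hc, le_neg, div_le_iff₀ hzt]
        constructor <;> intro h <;> linarith
      rw [← this, le_max_iff]
      exact ⟨fun h => h.resolve_right (not_le.2 hMb), Or.inl⟩
  have h1 : countSup c (gppPath M w z) ≤ b ↔
      ∀ k : ℕ, w ≤ b * (|c| * z (TopologicalSpace.denseSeq I k)) := by
    rw [countSup, ciSup_le_iff hbdd]
    exact forall_congr' fun k => hpt _
  rw [h1]
  have hc' : 0 < |c| := abs_pos.2 hc.ne
  constructor
  · intro h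
    have hall : ∀ t, w ≤ b * (|c| * z t) := by
      intro t
      have hcl : IsClosed {t | w ≤ b * (|c| * z t)} :=
        isClosed_le continuous_const (by fun_prop)
      have hsub : Set.range (TopologicalSpace.denseSeq I) ⊆ {t | w ≤ b * (|c| * z t)} := by
        rintro _ ⟨k, rfl⟩; exact h k
      exact closure_minimal hsub hcl ((TopologicalSpace.denseRange_denseSeq I) t)
    have hb0 : 0 < b := by
      rcases hb.1.eq_or_lt with h0 | h0
      · have := hall 0
        rw [← h0, zero_mul] at this
        linarith
      · exact h0
    have : w / (b * |c|) ≤ ⨅ t, z t := le_ciInf fun t => by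
      rw [div_le_iff₀ (by positivity)]
      linarith [hall t]
    rw [div_le_iff₀ (by positivity)] at this
    linarith
  · intro h k
    refine h.trans ?_
    have := hb.1
    gcongr
    exact ciInf_le hbz _

open Classical in
-- Two nonnegative numbers with the same comparisons against every b ∈ [0,1] have the same
-- truncation. The case of infimum zero is separate because division by zero would give the quotient
-- 0, a spurious point in [0,1].
lemma truncUnit_countSup_gppPath (hM : M < 0) (hc : c < 0) (hMc : M < c) (hw : 0 < w)
    (hz : ∀ t, 0 ≤ z t) (hcont : Continuous z) :
    truncUnit (countSup c (gppPath M w z)) =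
      if 0 < ⨅ t, z t then truncUnit (w / (|c| * ⨅ t, z t)) else 2 := by
  set y := ⨅ t, z t with hy
  set V := countSup c (gppPath M w z) with hV
  have hV0 : 0 ≤ V := countSup_gppPath_nonneg hM hc hw hz
  have hiff {b : ℝ} (hb : b ∈ Set.Icc (0 : ℝ) 1) : V ≤ b ↔ w ≤ b * (|c| * y) :=
    countSup_gppPath_le_iff hM hc hMc hw hz hcont hb
  have hc' : 0 < |c| := abs_pos.2 hc.ne
  split_ifs with h
  · have hcy : 0 < |c| * y := mul_pos hc' h
    have hiff' {b : ℝ} (hb : b ∈ Set.Icc (0 : ℝ) 1) : V ≤ b ↔ w / (|c| * y) ≤ b := by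
      rw [hiff hb, div_le_iff₀ hcy]
    have hU0 : 0 ≤ w / (|c| * y) := by positivity
    by_cases hU : w / (|c| * y) ≤ 1
    · have hVU : V ≤ w / (|c| * y) := (hiff' ⟨hU0, hU⟩).2 le_rfl
      have hUV : w / (|c| * y) ≤ V := (hiff' ⟨hV0, hVU.trans hU⟩).1 le_rfl
      rw [le_antisymm hVU hUV]
    · rw [truncUnit_of_notMem (fun hh => hU hh.2),
        truncUnit_of_notMem (fun hh => hU ((hiff' (by norm_num)).1 hh.2))]
  · refine truncUnit_of_notMem fun hh => ?_
    have hle := (hiff (b := 1) (by norm_num)).1 hh.2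
    have hy0 : 0 ≤ y := Real.iInf_nonneg hz
    have : y = 0 := le_antisymm (not_lt.1 h) hy0
    rw [this] at hle
    linarith

end Path

/-! ### Law of a truncated observation. -/

/-- The law with density `f` on `[0,1]` whose remaining mass sits at the point `2`. -/
def truncLaw (f : ℝ → ℝ) : Measure ℝ :=
  (volume.restrict (Set.Icc (0 : ℝ) 1)).withDensity (fun v => ENNReal.ofReal (f v)) +
    ENNReal.ofReal (1 - ∫ v in Set.Icc (0 : ℝ) 1, f v) • Measure.dirac 2

/-- The mass of the atom is forced by total mass one. -/
lemma eq_truncLaw {κ : Measure ℝ} [IsProbabilityMeasure κ] {f : ℝ → ℝ}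
    (hf0 : ∀ v ∈ Set.Icc (0 : ℝ) 1, 0 ≤ f v)
    (hfi : IntegrableOn f (Set.Icc 0 1))
    (hsupp : κ (Set.Icc (0 : ℝ) 1 ∪ {2})ᶜ = 0)
    (hκ : ∀ B, MeasurableSet B → B ⊆ Set.Icc 0 1 → κ B = ∫⁻ v in B, ENNReal.ofReal (f v)) :
    κ = truncLaw f := by
  classical
  have hIcc := hκ _ measurableSet_Icc subset_rfl
  rw [← ofReal_integral_eq_lintegral_ofReal hfi
    ((ae_restrict_iff' measurableSet_Icc).2 (.of_forall hf0))] at hIcc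
  have hint0 : 0 ≤ ∫ v in Set.Icc (0 : ℝ) 1, f v := setIntegral_nonneg measurableSet_Icc hf0
  have htwo : κ {2} = ENNReal.ofReal (1 - ∫ v in Set.Icc (0 : ℝ) 1, f v) := by
    have h1 : κ (Set.Icc (0 : ℝ) 1 ∪ {2}) = 1 :=
      (prob_compl_eq_zero_iff (measurableSet_Icc.union (measurableSet_singleton _))).1 hsupp
    rw [measure_union (by simp) (measurableSet_singleton _), hIcc] at h1
    rw [ENNReal.ofReal_sub _ hint0, ENNReal.ofReal_one, ← h1,
      ENNReal.add_sub_cancel_left ENNReal.ofReal_ne_top]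
  ext B hB
  have hsplit : κ B = κ (B ∩ Set.Icc 0 1) + κ (B ∩ {2}) := by
    rw [← measure_union _ (hB.inter (measurableSet_singleton _)), ← Set.inter_union_distrib_left]
    · exact (measure_inter_conull hsupp).symm
    · exact (Set.disjoint_singleton_right.2 two_notMem_Icc).mono Set.inter_subset_right
        Set.inter_subset_right
  rw [hsplit, hκ _ (hB.inter measurableSet_Icc) Set.inter_subset_right, truncLaw,
    Measure.add_apply, withDensity_apply _ hB, Measure.restrict_restrict hB, Measure.smul_apply,
    Measure.dirac_apply' _ hB, smul_eq_mul]
  congr 1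
  by_cases h2 : (2 : ℝ) ∈ B
  · rw [Set.inter_eq_self_of_subset_right (Set.singleton_subset_iff.2 h2), htwo]
    simp [h2]
  · rw [Set.inter_singleton_eq_empty.2 h2]
    simp [h2]

lemma lintegral_scale {a : ℝ} (ha : 0 < a) {F : ℝ → ENNReal} (hF : Measurable F) :
    ∫⁻ w, F w = ENNReal.ofReal a * ∫⁻ v, F (a * v) := by
  conv_lhs => rw [← Real.smul_map_volume_mul_left ha.ne', lintegral_smul_measure,
    lintegral_map hF (measurable_const_mul a), abs_of_pos ha, smul_eq_mul]

/-- The density `|c| E(Y h(|c| Y v))` at `v ∈ [0,1]` of `W / (|c| Y)`, for `W` with density `h` on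
`[0,1]` and an independent `Y` with law `ν`. -/
def ratioDensity (h : ℝ → ℝ) (ν : Measure ℝ) (c v : ℝ) : ℝ :=
  ∫ y, |c| * y * h (|c| * y * v) ∂ν

lemma measurable_ratioDensity {h : ℝ → ℝ} (hh : Measurable h) (ν : Measure ℝ) [SFinite ν] (c : ℝ) :
    Measurable (ratioDensity h ν c) := by
  unfold ratioDensity
  refine StronglyMeasurable.measurable (StronglyMeasurable.integral_prod_right
    (f := fun v y => |c| * y * h (|c| * y * v)) (Measurable.stronglyMeasurable ?_))
  fun_prop

lemma integrable_ratioDensity_integrand {h : ℝ → ℝ} (hh : Measurable h) {K : ℝ}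
    (hK : ∀ u, |h u| ≤ K) {ν : Measure ℝ} [IsFiniteMeasure ν] {m : ℝ}
    (hν : ∀ᵐ y ∂ν, 0 ≤ y ∧ y ≤ m) (c v : ℝ) :
    Integrable (fun y => |c| * y * h (|c| * y * v)) ν := by
  refine Integrable.of_bound (C := |c| * m * K) (Measurable.aestronglyMeasurable (by fun_prop)) ?_
  filter_upwards [hν] with y hy
  rw [Real.norm_eq_abs, abs_mul, abs_mul, abs_abs, abs_of_nonneg hy.1]
  have := hK (|c| * y * v)
  have := (abs_nonneg _).trans this
  have := hy.1.trans hy.2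
  gcongr
  exact hy.2

/-- Condition on y and substitute w = |c|yv, then exchange integrals. The bound |c|m ≤ 1 keeps |c|yv
in [0,1] for v ∈ [0,1], so the support constraint on W is automatic; y = 0 contributes nothing on
either side. -/
lemma measure_ratio_mem {h : ℝ → ℝ} (hh : Measurable h) (hh0 : ∀ u, 0 ≤ h u) {K : ℝ}
    (hK : ∀ u, |h u| ≤ K) {ν : Measure ℝ} [IsFiniteMeasure ν] {m : ℝ}
    (hν : ∀ᵐ y ∂ν, 0 ≤ y ∧ y ≤ m) {c : ℝ} (hc : c ≠ 0) (hcm : |c| * m ≤ 1)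
    {B : Set ℝ} (hB : MeasurableSet B) (hBI : B ⊆ Set.Icc 0 1) :
    ν.prod ((volume.restrict (Set.Icc (0 : ℝ) 1)).withDensity fun u => ENNReal.ofReal (h u))
        {x : ℝ × ℝ | 0 < x.1 ∧ x.2 / (|c| * x.1) ∈ B} =
      ∫⁻ v in B, ENNReal.ofReal (ratioDensity h ν c v) := by
  have hS : MeasurableSet {x : ℝ × ℝ | 0 < x.1 ∧ x.2 / (|c| * x.1) ∈ B} := by
    apply MeasurableSet.inter
    · exact measurableSet_lt measurable_const measurable_fst
    · have : Measurable fun x : ℝ × ℝ => x.2 / (|c| * x.1) := by fun_prop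
      exact this hB
  have hc' : 0 < |c| := abs_pos.2 hc
  have hhm := hh.ennreal_ofReal
  rw [Measure.prod_apply hS]
  have hinner : ∀ᵐ y ∂ν,
      ((volume.restrict (Set.Icc (0 : ℝ) 1)).withDensity fun u => ENNReal.ofReal (h u))
        (Prod.mk y ⁻¹' {x : ℝ × ℝ | 0 < x.1 ∧ x.2 / (|c| * x.1) ∈ B}) =
      ∫⁻ v in B, ENNReal.ofReal (|c| * y * h (|c| * y * v)) := by
    filter_upwards [hν] with y hy
    rcases hy.1.eq_or_lt with h0 | h0
    · simp [← h0]
    · have ha : 0 < |c| * y := mul_pos hc' h0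
      have hpre : MeasurableSet {w : ℝ | w / (|c| * y) ∈ B} := (measurable_id.div_const _) hB
      have hset : Prod.mk y ⁻¹' {x : ℝ × ℝ | 0 < x.1 ∧ x.2 / (|c| * x.1) ∈ B} =
          {w : ℝ | w / (|c| * y) ∈ B} := by
        ext w; simp [h0]
      have hcomp : Measurable fun v : ℝ => ({w : ℝ | w / (|c| * y) ∈ B} ∩ Set.Icc 0 1).indicator
          (fun x => ENNReal.ofReal (h x)) (|c| * y * v) :=
        (hhm.indicator (hpre.inter measurableSet_Icc)).comp (measurable_const_mul _)
      rw [hset, withDensity_apply _ hpre, Measure.restrict_restrict hpre,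
        ← lintegral_indicator (hpre.inter measurableSet_Icc),
        lintegral_scale ha (hhm.indicator (hpre.inter measurableSet_Icc)),
        ← lintegral_const_mul _ hcomp, ← lintegral_indicator hB]
      refine lintegral_congr fun v => ?_
      by_cases hv : v ∈ B
      · rw [Set.indicator_of_mem hv, Set.indicator_of_mem, ENNReal.ofReal_mul ha.le]
        refine ⟨by simpa [mul_div_cancel_left₀ _ ha.ne'] using hv, ?_, ?_⟩
        · exact mul_nonneg ha.le (hBI hv).1
        · have h1 : |c| * y ≤ 1 := (mul_le_mul_of_nonneg_left hy.2 hc'.le).trans hcm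
          exact mul_le_one₀ h1 (hBI hv).1 (hBI hv).2
      · rw [Set.indicator_of_notMem hv, Set.indicator_of_notMem, mul_zero]
        rintro ⟨hh1, -⟩
        exact hv (by simpa [mul_div_cancel_left₀ _ ha.ne'] using hh1)
  rw [lintegral_congr_ae hinner, lintegral_lintegral_swap
    (Measurable.aemeasurable (by fun_prop))]
  refine lintegral_congr fun v => ?_
  rw [ratioDensity, ofReal_integral_eq_lintegral_ofReal
    (integrable_ratioDensity_integrand hh hK hν c v)]
  filter_upwards [hν] with y hy
  exact mul_nonneg (mul_nonneg hc'.le hy.1) (hh0 _)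

/-! ### The exponential family and the laws in the model. -/

section ExpDensity

variable {T : ℝ → ℝ} {K : ℝ}

lemma integrableOn_exp_mul (hT : Measurable T) (hK : ∀ u, |T u| ≤ K) (ϑ : ℝ) :
    IntegrableOn (fun u => Real.exp (ϑ * T u)) (Set.Icc 0 1) := by
  refine integrable_of_measurable_of_bound (K := Real.exp (|ϑ| * K)) (by fun_prop) fun u => ?_
  rw [abs_of_pos (Real.exp_pos _), Real.exp_le_exp]
  refine (le_abs_self _).trans ?_
  rw [abs_mul]
  exact mul_le_mul_of_nonneg_left (hK u) (abs_nonneg _)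

lemma normConst_pos (hT : Measurable T) (hK : ∀ u, |T u| ≤ K) (ϑ : ℝ) : 0 < normConst T ϑ := by
  unfold normConst
  refine one_div_pos.2 (integral_exp_pos (integrableOn_exp_mul hT hK ϑ) (hμ := ?_))
  exact ⟨by simp⟩

lemma expDensity_pos (hT : Measurable T) (hK : ∀ u, |T u| ≤ K) (ϑ u : ℝ) :
    0 < expDensity T ϑ u :=
  mul_pos (normConst_pos hT hK ϑ) (Real.exp_pos _)

lemma measurable_expDensity (hT : Measurable T) (ϑ : ℝ) : Measurable (expDensity T ϑ) := by
  unfold expDensity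
  fun_prop

lemma exists_abs_expDensity_le (hT : Measurable T) (hK : ∀ u, |T u| ≤ K) (ϑ : ℝ) :
    ∃ B, ∀ u, |expDensity T ϑ u| ≤ B := by
  refine ⟨normConst T ϑ * Real.exp (|ϑ| * K), fun u => ?_⟩
  rw [abs_of_pos (expDensity_pos hT hK ϑ u)]
  refine mul_le_mul_of_nonneg_left ?_ (normConst_pos hT hK ϑ).le
  rw [Real.exp_le_exp]
  refine (le_abs_self _).trans ?_
  rw [abs_mul]
  exact mul_le_mul_of_nonneg_left (hK u) (abs_nonneg _)

lemma expDensity_zero (T : ℝ → ℝ) (u : ℝ) : expDensity T 0 u = 1 := by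
  simp [expDensity, normConst]

end ExpDensity

section Model

variable {Ω : Type*} [MeasurableSpace Ω] {T : ℝ → ℝ} {M : ℝ} {P : ℝ → Measure Ω}
  {W : Ω → ℝ} {Z : Ω → I → ℝ} {X : ℕ → Ω → I → ℝ}

lemma IsExpModel.ae_pos_W (hmodel : IsExpModel T M P W Z X) (ϑ : ℝ) : ∀ᵐ ω ∂P ϑ, 0 < W ω := by
  refine ae_of_ae_map (p := fun w => 0 < w) hmodel.measurable_W.aemeasurable ?_
  rw [hmodel.law_W]
  refine (withDensity_absolutelyContinuous _ _).ae_le ?_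
  change ∀ᵐ w ∂volume.restrict (Set.Icc (0 : ℝ) 1), 0 < w
  rw [← restrict_Ioc_eq_restrict_Icc, ae_restrict_iff' measurableSet_Ioc]
  exact .of_forall fun w hw => hw.1

lemma IsExpModel.ae_nonneg_Z (hmodel : IsExpModel T M P W Z X) (ϑ : ℝ) :
    ∀ᵐ ω ∂P ϑ, ∀ t, 0 ≤ Z ω t := by
  obtain ⟨m, -, hm⟩ := (hmodel.generator ϑ).bounded
  filter_upwards [hm] with ω hω t using (hω t).1

lemma IsExpModel.measurable_iInf (hmodel : IsExpModel T M P W Z X) :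
    Measurable fun ω => ⨅ t, Z ω t := by
  obtain ⟨g, hg, hgZ⟩ := exists_measurable_eq_iInf (hmodel.generator 0).continuous
  simp_rw [← hgZ]
  exact hg.comp (hmodel.generator 0).measurable

lemma IsExpModel.exists_bound_iInf (hmodel : IsExpModel T M P W Z X) :
    ∃ m : ℝ, 1 ≤ m ∧ ∀ᵐ y ∂(P 0).map (fun ω => ⨅ t, Z ω t), 0 ≤ y ∧ y ≤ m := by
  obtain ⟨m, hm1, hm⟩ := (hmodel.generator 0).bounded
  refine ⟨m, hm1, ?_⟩
  refine (ae_map_iff (p := fun y => 0 ≤ y ∧ y ≤ m) hmodel.measurable_iInf.aemeasurable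
    ((measurableSet_Ici (a := (0 : ℝ))).inter (measurableSet_Iic (a := m)))).2 ?_
  filter_upwards [hm] with ω hω
  refine ⟨Real.iInf_nonneg fun t => (hω t).1, ?_⟩
  exact (ciInf_le ⟨0, by rintro _ ⟨t, rfl⟩; exact (hω t).1⟩ (0 : I)).trans (hω 0).2

/-- Independence gives the product, and since the law of Z is free of ϑ the first factor can be
taken under `P 0`; ϑ enters only through W. -/
lemma IsExpModel.map_iInf_prod [∀ ϑ, IsProbabilityMeasure (P ϑ)]
    (hmodel : IsExpModel T M P W Z X) (ϑ : ℝ) :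
    (P ϑ).map (fun ω => (⨅ t, Z ω t, W ω)) =
      ((P 0).map fun ω => ⨅ t, Z ω t).prod (expFamily T ϑ) := by
  have hZ := (hmodel.generator 0).measurable
  obtain ⟨g, hg, hgZ⟩ := exists_measurable_eq_iInf (hmodel.generator 0).continuous
  have hY := hmodel.measurable_iInf
  simp_rw [← hgZ] at hY ⊢
  have hind : IndepFun (fun ω => g (Z ω)) W (P ϑ) :=
    (hmodel.indep_W_Z ϑ).symm.comp hg measurable_id
  rw [(indepFun_iff_map_prod_eq_prod_map_map hY.aemeasurable
    hmodel.measurable_W.aemeasurable).1 hind, hmodel.law_W]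
  congr 1
  have h (ϑ : ℝ) : (P ϑ).map (fun ω => g (Z ω)) = ((P ϑ).map Z).map g :=
    (Measure.map_map hg hZ).symm
  rw [h, h, hmodel.law_Z]

lemma IsExpModel.identDistrib_countSup (hmodel : IsExpModel T M P W Z X) (c ϑ : ℝ) (i : ℕ) :
    IdentDistrib (fun ω => countSup c (X i ω)) (fun ω => countSup c (gppPath M (W ω) (Z ω)))
      (P ϑ) (P ϑ) :=
  (hmodel.copies ϑ i).comp (measurable_countSup c)

lemma IsExpModel.ae_countSup_nonneg (hmodel : IsExpModel T M P W Z X) (hM : M < 0) {c : ℝ}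
    (hc : c < 0) (ϑ : ℝ) (i : ℕ) : ∀ᵐ ω ∂P ϑ, 0 ≤ countSup c (X i ω) := by
  refine (hmodel.identDistrib_countSup c ϑ i).symm.ae_snd (p := fun v => 0 ≤ v)
    measurableSet_Ici ?_
  filter_upwards [hmodel.ae_pos_W ϑ, hmodel.ae_nonneg_Z ϑ] with ω h1 h2
  exact countSup_gppPath_nonneg hM hc h1 h2

lemma IsExpModel.ae_countSup_eq (hmodel : IsExpModel T M P W Z X) (c ϑ : ℝ) :
    ∀ᵐ ω ∂P ϑ, ∀ i, countSup c (X i ω) = supRatio c (X i ω) := by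
  rw [ae_all_iff]
  intro i
  filter_upwards [hmodel.continuous_X ϑ i] with ω hω
  exact countSup_eq_supRatio hω

lemma integrableOn_ratioDensity {h : ℝ → ℝ} (hh : Measurable h) {B : ℝ}
    (hB : ∀ u, |h u| ≤ B) {ν : Measure ℝ} [IsProbabilityMeasure ν] {m : ℝ}
    (hν : ∀ᵐ y ∂ν, 0 ≤ y ∧ y ≤ m) (c : ℝ) :
    IntegrableOn (ratioDensity h ν c) (Set.Icc 0 1) := by
  refine integrable_of_measurable_of_bound (K := |c| * m * B) (measurable_ratioDensity hh ν c)
    fun v => ?_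
  have := norm_integral_le_of_norm_le_const (μ := ν)
    (f := fun y => |c| * y * h (|c| * y * v)) (C := |c| * m * B) (by
      filter_upwards [hν] with y hy
      rw [Real.norm_eq_abs, abs_mul, abs_mul, abs_abs, abs_of_nonneg hy.1]
      have h1 := (abs_nonneg _).trans (hB (|c| * y * v))
      have h2 := hy.1.trans hy.2
      gcongr
      exacts [hy.2, hB _])
  simpa [ratioDensity] using this

theorem IsExpModel.map_truncUnit_countSup [∀ ϑ, IsProbabilityMeasure (P ϑ)]
    (hmodel : IsExpModel T M P W Z X)
    (hT : Measurable T) {K : ℝ} (hK : ∀ u, |T u| ≤ K) (hM : M < 0) {c : ℝ} (hc : c < 0)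
    (hMc : M < c) {m : ℝ} (hm : ∀ᵐ y ∂(P 0).map (fun ω => ⨅ t, Z ω t), 0 ≤ y ∧ y ≤ m)
    (hcm : |c| * m ≤ 1) (ϑ : ℝ) (i : ℕ) :
    (P ϑ).map (fun ω => truncUnit (countSup c (X i ω))) =
      truncLaw (ratioDensity (expDensity T ϑ) ((P 0).map fun ω => ⨅ t, Z ω t) c) := by
  classical
  set ν := (P 0).map fun ω => ⨅ t, Z ω t with hν
  have hY := hmodel.measurable_iInf
  have hνp : IsProbabilityMeasure ν := Measure.isProbabilityMeasure_map hY.aemeasurable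
  have hhm := measurable_expDensity hT ϑ
  have hhp := expDensity_pos hT hK ϑ
  obtain ⟨B₀, hB₀⟩ := exists_abs_expDensity_le hT hK ϑ
  set V : Ω → ℝ := fun ω =>
    if 0 < ⨅ t, Z ω t then truncUnit (W ω / (|c| * ⨅ t, Z ω t)) else 2 with hV
  have hVm : Measurable V := by
    refine Measurable.ite (measurableSet_lt measurable_const hY)
      (measurable_truncUnit.comp (hmodel.measurable_W.div (hY.const_mul _))) measurable_const
  have hlaw : (P ϑ).map (fun ω => truncUnit (countSup c (X i ω))) = (P ϑ).map V := by
    refine ((hmodel.identDistrib_countSup c ϑ i).comp measurable_truncUnit).map_eq.trans ?_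
    refine Measure.map_congr ?_
    filter_upwards [hmodel.ae_pos_W ϑ, hmodel.ae_nonneg_Z ϑ] with ω h1 h2
    exact truncUnit_countSup_gppPath hM hc hMc h1 h2 ((hmodel.generator ϑ).continuous ω)
  rw [hlaw]
  have hVp : IsProbabilityMeasure ((P ϑ).map V) :=
    Measure.isProbabilityMeasure_map hVm.aemeasurable
  have htr (v : ℝ) : truncUnit v ∈ Set.Icc (0 : ℝ) 1 ∪ {2} := by
    by_cases h : v ∈ Set.Icc (0 : ℝ) 1
    · rw [truncUnit_of_mem h]; exact Or.inl h
    · rw [truncUnit_of_notMem h]; exact Or.inr rfl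
  refine eq_truncLaw ?_ (integrableOn_ratioDensity hhm hB₀ hm c) ?_ ?_
  · intro v _
    refine integral_nonneg_of_ae ?_
    filter_upwards [hm] with y hy
    exact mul_nonneg (mul_nonneg (abs_nonneg _) hy.1) (hhp _).le
  · rw [Measure.map_apply hVm (measurableSet_Icc.union (measurableSet_singleton _)).compl]
    convert measure_empty (μ := P ϑ)
    ext ω
    simp only [Set.mem_preimage, Set.mem_compl_iff, Set.mem_empty_iff_false, iff_false, not_not, hV]
    split_ifs
    · exact htr _
    · exact Or.inr rfl
  · intro B hB hBI
    have h2B : (2 : ℝ) ∉ B := fun h => two_notMem_Icc (hBI h)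
    rw [Measure.map_apply hVm hB, ← measure_ratio_mem hhm (fun u => (hhp u).le) hB₀ hm hc.ne hcm
      hB hBI]
    have hS : MeasurableSet {x : ℝ × ℝ | 0 < x.1 ∧ x.2 / (|c| * x.1) ∈ B} := by
      apply MeasurableSet.inter
      · exact measurableSet_lt measurable_const measurable_fst
      · have : Measurable fun x : ℝ × ℝ => x.2 / (|c| * x.1) := by fun_prop
        exact this hB
    change _ = (ν.prod (expFamily T ϑ)) _
    rw [hν, ← hmodel.map_iInf_prod, Measure.map_apply (hY.prodMk hmodel.measurable_W) hS]
    congr 1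
    ext ω
    simp only [Set.mem_preimage, Set.mem_ofPred_eq, hV]
    split_ifs with h
    · by_cases hu : W ω / (|c| * ⨅ t, Z ω t) ∈ Set.Icc (0 : ℝ) 1
      · simp [truncUnit_of_mem hu, h]
      · rw [truncUnit_of_notMem hu]
        exact iff_of_false h2B fun hh => hu (hBI hh.2)
    · exact iff_of_false h2B fun hh => h hh.1

end Model

/-! ### Expansion of the densities near ϑ = 0 and u = 0. -/

lemma abs_integral_exp_mul_sub_le {T : ℝ → ℝ} {K : ℝ} (hT : Measurable T) (hK : ∀ u, |T u| ≤ K)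
    {ϑ : ℝ} (hϑ : |ϑ| * K ≤ 1) :
    |(∫ u in Set.Icc (0 : ℝ) 1, Real.exp (ϑ * T u)) - (1 + ϑ * ∫ u in Set.Icc (0 : ℝ) 1, T u)| ≤
      ϑ ^ 2 * K ^ 2 := by
  have hTi : IntegrableOn T (Set.Icc 0 1) := integrable_of_measurable_of_bound hT hK
  have hc : IntegrableOn (fun _ : ℝ => (1 : ℝ)) (Set.Icc (0 : ℝ) 1) := integrable_const _
  have e : ∫ u in Set.Icc (0 : ℝ) 1, (Real.exp (ϑ * T u) - (1 + ϑ * T u)) =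
      (∫ u in Set.Icc (0 : ℝ) 1, Real.exp (ϑ * T u)) -
        (1 + ϑ * ∫ u in Set.Icc (0 : ℝ) 1, T u) := by
    have hlin : IntegrableOn (fun u => 1 + ϑ * T u) (Set.Icc 0 1) := hc.add (hTi.const_mul ϑ)
    rw [integral_sub (integrableOn_exp_mul hT hK ϑ) hlin,
      integral_add hc (hTi.const_mul ϑ), integral_const_mul]
    simp
  rw [← e]
  have h := norm_setIntegral_le_of_norm_le_const (μ := volume) (s := Set.Icc (0 : ℝ) 1)
    (f := fun u => Real.exp (ϑ * T u) - (1 + ϑ * T u)) (C := ϑ ^ 2 * K ^ 2) (by simp)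
    (fun u _ => by
      have h1 : |ϑ * T u| ≤ |ϑ| * K := by
        rw [abs_mul]; exact mul_le_mul_of_nonneg_left (hK u) (abs_nonneg _)
      have h2 := Real.abs_exp_sub_one_sub_id_le (h1.trans hϑ)
      rw [Real.norm_eq_abs, show Real.exp (ϑ * T u) - (1 + ϑ * T u) =
        Real.exp (ϑ * T u) - 1 - ϑ * T u by ring]
      refine h2.trans ?_
      rw [← sq_abs (ϑ * T u), ← sq_abs ϑ, ← mul_pow]
      exact pow_le_pow_left₀ (abs_nonneg _) h1 2)
  simpa using h

/-- First order expansion of the exponential family near the parameter `0` and the point `0`. -/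
lemma exists_abs_expDensity_sub_le {T : ℝ → ℝ} {K C : ℝ} (hT : Measurable T)
    (hK : ∀ u, |T u| ≤ K) (hlim : Tendsto T (𝓝[≥] 0) (𝓝 C)) {ε : ℝ} (hε : 0 < ε) :
    ∃ δ > 0, ∀ ϑ, |ϑ| ≤ δ → ∀ u ∈ Set.Icc 0 δ,
      |expDensity T ϑ u - (1 + ϑ * (C - ∫ u in Set.Icc (0 : ℝ) 1, T u))| ≤ ε * |ϑ| := by
  have hK0 : 0 ≤ K := (abs_nonneg _).trans (hK 0)
  set S := ∫ u in Set.Icc (0 : ℝ) 1, T u with hS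
  set D := C - S with hD
  have hSK : |S| ≤ K := by
    have := norm_setIntegral_le_of_norm_le_const (μ := volume) (s := Set.Icc (0 : ℝ) 1)
      (f := T) (C := K) (by simp) (fun u _ => hK u)
    simpa using this
  set L := K ^ 2 + K * |D| + K ^ 2 * (1 + |D|) with hL
  have hL0 : 0 ≤ L := by positivity
  obtain ⟨δ₁, hδ₁, hδT⟩ : ∃ δ₁ > 0, ∀ u ∈ Set.Icc 0 δ₁, |T u - C| ≤ ε / 4 := by
    have h := hlim.eventually (Metric.closedBall_mem_nhds C (by positivity : 0 < ε / 4))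
    rw [eventually_nhdsWithin_iff, Metric.eventually_nhds_iff] at h
    obtain ⟨r, hr, hh⟩ := h
    refine ⟨r / 2, by positivity, fun u hu => ?_⟩
    refine hh ?_ hu.1
    rw [Real.dist_eq, sub_zero, abs_of_nonneg hu.1]
    linarith [hu.2]
  -- The bounds serve in turn to bring T(u) within ε/4 of C, to give |1 + ϑD| ≤ 1 + |D|, to give
  -- |ϑ|K ≤ 1/4 and hence J ≥ 1/2, and to absorb the quadratic error ϑ²L into ε|ϑ|/4.
  refine ⟨min δ₁ (min 1 (min (1 / (4 * (K + 1))) (ε / (4 * (L + 1))))), by positivity, ?_⟩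
  intro ϑ hϑ u hu
  simp only [le_min_iff] at hϑ
  obtain ⟨-, h1, h2, h3⟩ := hϑ
  have hTu := hδT u ⟨hu.1, hu.2.trans (min_le_left _ _)⟩
  rw [le_div_iff₀ (by positivity)] at h2 h3
  have hϑK : |ϑ| * K ≤ 1 / 4 := by nlinarith [abs_nonneg ϑ]
  have hϑL : |ϑ| * L ≤ ε / 4 := by nlinarith [abs_nonneg ϑ]
  set J := ∫ u in Set.Icc (0 : ℝ) 1, Real.exp (ϑ * T u) with hJ
  have hρ₂ : |J - (1 + ϑ * S)| ≤ ϑ ^ 2 * K ^ 2 :=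
    abs_integral_exp_mul_sub_le hT hK (hϑK.trans (by norm_num))
  have hρ₁ : |Real.exp (ϑ * T u) - 1 - ϑ * T u| ≤ ϑ ^ 2 * K ^ 2 := by
    have h4 : |ϑ * T u| ≤ |ϑ| * K := by
      rw [abs_mul]; exact mul_le_mul_of_nonneg_left (hK u) (abs_nonneg _)
    refine (Real.abs_exp_sub_one_sub_id_le (h4.trans (hϑK.trans (by norm_num)))).trans ?_
    rw [← sq_abs (ϑ * T u), ← sq_abs ϑ, ← mul_pow]
    exact pow_le_pow_left₀ (abs_nonneg _) h4 2
  have hJ2 : 1 / 2 ≤ J := by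
    have h5 : ϑ ^ 2 * K ^ 2 ≤ 1 / 16 := by
      rw [← sq_abs ϑ, ← mul_pow]
      have := mul_nonneg (abs_nonneg ϑ) hK0
      nlinarith
    have h6 : |ϑ * S| ≤ 1 / 4 := by
      rw [abs_mul]; exact (mul_le_mul_of_nonneg_left hSK (abs_nonneg _)).trans hϑK
    have := (abs_le.1 hρ₂).1
    have := (abs_le.1 h6).1
    linarith
  have hJ0 : 0 < J := by linarith
  have e : expDensity T ϑ u - (1 + ϑ * D) = (Real.exp (ϑ * T u) - J * (1 + ϑ * D)) / J := by
    rw [expDensity, normConst, ← hJ]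
    field_simp
  -- The linear terms cancel because S + D = C.
  have e2 : Real.exp (ϑ * T u) - J * (1 + ϑ * D) = ϑ * (T u - C) +
      (Real.exp (ϑ * T u) - 1 - ϑ * T u) - ϑ ^ 2 * (S * D) -
        (J - (1 + ϑ * S)) * (1 + ϑ * D) := by
    rw [hD]; ring
  have hnum : |Real.exp (ϑ * T u) - J * (1 + ϑ * D)| ≤ |ϑ| * (ε / 4) + ϑ ^ 2 * L := by
    rw [e2]
    have b1 : |ϑ * (T u - C)| ≤ |ϑ| * (ε / 4) := by
      rw [abs_mul]; exact mul_le_mul_of_nonneg_left hTu (abs_nonneg _)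
    have b2 : |ϑ ^ 2 * (S * D)| ≤ ϑ ^ 2 * (K * |D|) := by
      rw [abs_mul, abs_mul, abs_of_nonneg (sq_nonneg ϑ)]
      gcongr
    have b3 : |(J - (1 + ϑ * S)) * (1 + ϑ * D)| ≤ ϑ ^ 2 * K ^ 2 * (1 + |D|) := by
      rw [abs_mul]
      have : |1 + ϑ * D| ≤ 1 + |D| := by
        refine (abs_add_le _ _).trans ?_
        rw [abs_one, abs_mul]
        have := mul_le_mul_of_nonneg_right h1 (abs_nonneg D)
        linarith
      gcongr
    have t1 := abs_sub (ϑ * (T u - C) + (Real.exp (ϑ * T u) - 1 - ϑ * T u) - ϑ ^ 2 * (S * D))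
      ((J - (1 + ϑ * S)) * (1 + ϑ * D))
    have t2 := abs_sub (ϑ * (T u - C) + (Real.exp (ϑ * T u) - 1 - ϑ * T u)) (ϑ ^ 2 * (S * D))
    have t3 := abs_add_le (ϑ * (T u - C)) (Real.exp (ϑ * T u) - 1 - ϑ * T u)
    rw [hL]
    linarith
  rw [e, abs_div, abs_of_pos hJ0, div_le_iff₀ hJ0]
  have hsq : ϑ ^ 2 * L ≤ |ϑ| * (ε / 4) := by
    rw [← sq_abs, sq, mul_assoc]
    exact mul_le_mul_of_nonneg_left hϑL (abs_nonneg _)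
  have : ε * |ϑ| * (1 / 2) ≤ ε * |ϑ| * J := mul_le_mul_of_nonneg_left hJ2 (by positivity)
  linarith

/-- As y ≤ m and |c|m ≤ δ, the density h is evaluated only on [0,δ]; the pointwise bound is
integrated against the weight |c|y. -/
lemma abs_ratioDensity_sub_le {h : ℝ → ℝ} (hh : Measurable h) {B : ℝ} (hB : ∀ u, |h u| ≤ B)
    {ν : Measure ℝ} [IsProbabilityMeasure ν] {m : ℝ} (hν : ∀ᵐ y ∂ν, 0 ≤ y ∧ y ≤ m)
    {c δ a e : ℝ} (hcm : |c| * m ≤ δ) (ha : ∀ u ∈ Set.Icc 0 δ, |h u - a| ≤ e)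
    {v : ℝ} (hv : v ∈ Set.Icc (0 : ℝ) 1) :
    |ratioDensity h ν c v - |c| * (∫ y, y ∂ν) * a| ≤ |c| * (∫ y, y ∂ν) * e := by
  have hy : Integrable (fun y : ℝ => y) ν := by
    refine Integrable.of_bound (C := m) measurable_id.aestronglyMeasurable ?_
    filter_upwards [hν] with y hy
    rw [Real.norm_eq_abs, abs_of_nonneg hy.1]
    exact hy.2
  have e1 : |c| * (∫ y, y ∂ν) * a = ∫ y, |c| * a * y ∂ν := by
    rw [integral_const_mul]; ring
  have e2 : |c| * (∫ y, y ∂ν) * e = ∫ y, |c| * e * y ∂ν := by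
    rw [integral_const_mul]; ring
  rw [e1, e2, ratioDensity, ← integral_sub (integrable_ratioDensity_integrand hh hB hν c v)
    (hy.const_mul _), ← Real.norm_eq_abs]
  refine norm_integral_le_of_norm_le (hy.const_mul (|c| * e)) ?_
  filter_upwards [hν] with y hy
  have hcy : 0 ≤ |c| * y := mul_nonneg (abs_nonneg _) hy.1
  have hle : |c| * y ≤ δ := (mul_le_mul_of_nonneg_left hy.2 (abs_nonneg _)).trans hcm
  rw [Real.norm_eq_abs, show |c| * y * h (|c| * y * v) - |c| * a * y =
    |c| * y * (h (|c| * y * v) - a) by ring, abs_mul, abs_of_nonneg hcy]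
  have := mul_le_mul_of_nonneg_left (ha (|c| * y * v)
    ⟨mul_nonneg hcy hv.1, (mul_le_of_le_one_right hcy hv.2).trans hle⟩) hcy
  linarith

lemma ratioDensity_one (ν : Measure ℝ) (c : ℝ) :
    ratioDensity (fun _ => 1) ν c = fun _ => |c| * ∫ y, y ∂ν := by
  ext v
  simp only [ratioDensity, mul_one]
  rw [integral_const_mul]

/-! ### Local asymptotic normality for truncated observations. -/

lemma truncLaw_const (p : ℝ) : truncLaw (fun _ => p) =
    ENNReal.ofReal p • volume.restrict (Set.Icc (0 : ℝ) 1) +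
      ENNReal.ofReal (1 - p) • Measure.dirac 2 := by
  simp [truncLaw, withDensity_const]

lemma integral_truncLaw_const {p : ℝ} (hp0 : 0 ≤ p) (hp1 : p ≤ 1) {g : ℝ → ℝ} (hg : Measurable g)
    {K : ℝ} (hK : ∀ v, |g v| ≤ K) :
    ∫ v, g v ∂truncLaw (fun _ => p) = p * (∫ v in Set.Icc (0 : ℝ) 1, g v) + (1 - p) * g 2 := by
  have h1 : Integrable g (volume.restrict (Set.Icc (0 : ℝ) 1)) :=
    integrable_of_measurable_of_bound hg hK
  have h2 : Integrable g (Measure.dirac (2 : ℝ)) := integrable_of_measurable_of_bound hg hK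
  rw [truncLaw_const, integral_add_measure (h1.smul_measure ENNReal.ofReal_ne_top)
    (h2.smul_measure ENNReal.ofReal_ne_top), integral_smul_measure, integral_smul_measure,
    integral_dirac, ENNReal.toReal_ofReal hp0, ENNReal.toReal_ofReal (by linarith)]
  rfl

open Classical in
/-- The likelihood ratio of `truncLaw f` with respect to `truncLaw (fun _ => p)`. -/
def truncRatio (f : ℝ → ℝ) (p v : ℝ) : ℝ :=
  if v ∈ Set.Icc (0 : ℝ) 1 then f v / p else (1 - ∫ v in Set.Icc (0 : ℝ) 1, f v) / (1 - p)

lemma measurable_truncRatio {f : ℝ → ℝ} (hf : Measurable f) (p : ℝ) :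
    Measurable (truncRatio f p) :=
  Measurable.ite measurableSet_Icc (hf.div_const p) measurable_const

lemma truncRatio_of_notMem {f : ℝ → ℝ} {p v : ℝ} (hv : v ∉ Set.Icc (0 : ℝ) 1) :
    truncRatio f p v = (1 - ∫ v in Set.Icc (0 : ℝ) 1, f v) / (1 - p) := if_neg hv

lemma truncLaw_eq_withDensity {f : ℝ → ℝ} (hf : Measurable f) {p : ℝ} (hp0 : 0 < p) (hp1 : p < 1) :
    truncLaw f = (truncLaw fun _ => p).withDensity
      fun v => ENNReal.ofReal (truncRatio f p v) := by
  have hm := (measurable_truncRatio hf p).ennreal_ofReal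
  rw [truncLaw_const, withDensity_add_measure, withDensity_smul_measure, withDensity_smul_measure,
    truncLaw]
  congr 1
  · rw [← withDensity_smul _ hm]
    refine withDensity_congr_ae ?_
    filter_upwards [ae_restrict_mem measurableSet_Icc] with v hv
    simp only [Pi.smul_apply, smul_eq_mul]
    rw [← ENNReal.ofReal_mul hp0.le, truncRatio, if_pos hv, mul_div_cancel₀ _ hp0.ne']
  · rw [dirac_withDensity' hm, smul_smul, ← ENNReal.ofReal_mul (by linarith),
      truncRatio_of_notMem two_notMem_Icc, mul_div_cancel₀ _ (by linarith)]

open Classical in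
/-- The centred and scaled indicator function of `[0,1]`. -/
def scaledIndicator (a p v : ℝ) : ℝ :=
  if v ∈ Set.Icc (0 : ℝ) 1 then a * (1 - p) else -(a * p)

lemma measurable_scaledIndicator (a p : ℝ) : Measurable (scaledIndicator a p) :=
  Measurable.ite measurableSet_Icc measurable_const measurable_const

lemma abs_scaledIndicator_le {p : ℝ} (hp0 : 0 ≤ p) (hp1 : p ≤ 1) (a v : ℝ) :
    |scaledIndicator a p v| ≤ |a| := by
  unfold scaledIndicator
  split_ifs
  · rw [abs_mul, abs_of_nonneg (by linarith : 0 ≤ 1 - p)]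
    exact mul_le_of_le_one_right (abs_nonneg _) (by linarith)
  · rw [abs_neg, abs_mul, abs_of_nonneg hp0]
    exact mul_le_of_le_one_right (abs_nonneg _) hp1

lemma setIntegral_Icc_congr_const {g : ℝ → ℝ} {b : ℝ} (hg : ∀ v ∈ Set.Icc (0 : ℝ) 1, g v = b) :
    ∫ v in Set.Icc (0 : ℝ) 1, g v = b := by
  rw [setIntegral_congr_fun measurableSet_Icc hg]
  simp

lemma integral_scaledIndicator {p : ℝ} (hp0 : 0 ≤ p) (hp1 : p ≤ 1) (a : ℝ) :
    ∫ v, scaledIndicator a p v ∂truncLaw (fun _ => p) = 0 := by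
  rw [integral_truncLaw_const hp0 hp1 (measurable_scaledIndicator a p)
    (abs_scaledIndicator_le hp0 hp1 a), setIntegral_Icc_congr_const (b := a * (1 - p))
    fun v hv => by rw [scaledIndicator, if_pos hv], scaledIndicator, if_neg two_notMem_Icc]
  ring

lemma integral_scaledIndicator_sq {p : ℝ} (hp0 : 0 ≤ p) (hp1 : p ≤ 1) (a : ℝ) :
    ∫ v, scaledIndicator a p v ^ 2 ∂truncLaw (fun _ => p) = a ^ 2 * p * (1 - p) := by
  rw [integral_truncLaw_const hp0 hp1 ((measurable_scaledIndicator a p).pow_const 2)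
    (K := |a| ^ 2) (fun v => by
      rw [abs_pow]
      exact pow_le_pow_left₀ (abs_nonneg _) (abs_scaledIndicator_le hp0 hp1 a v) 2),
    setIntegral_Icc_congr_const (b := (a * (1 - p)) ^ 2)
    fun v hv => by rw [scaledIndicator, if_pos hv], scaledIndicator, if_neg two_notMem_Icc]
  ring

lemma mul_mul_div_sqrt_sq {n : ℕ} {p : ℝ} (hnp : 0 < n * p) (ξ : ℝ) :
    n * p * (ξ / √(n * p)) ^ 2 = ξ ^ 2 := by
  rw [div_pow, Real.sq_sqrt hnp.le, mul_div_cancel₀ _ hnp.ne']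

/-- Quadratic expansion of the loglikelihood ratio of truncated observations whose null law is
uniform on `[0,1]` with total mass `p n`. -/
theorem tendstoInMeasure_sum_log_truncRatio {Ω : Type*} [MeasurableSpace Ω] {μ : Measure Ω}
    [IsProbabilityMeasure μ] {V : ℕ → ℕ → Ω → ℝ} {Q : ℕ → Measure ℝ}
    [∀ n, IsProbabilityMeasure (Q n)]
    (hV : ∀ n i, Measurable (V n i)) (hind : ∀ n, iIndepFun (V n) μ)
    (hVQ : ∀ n i, μ.map (V n i) = Q n) {p : ℕ → ℝ} (hp0 : ∀ n, 0 < p n)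
    (hp : Tendsto p atTop (𝓝 0)) (hk : Tendsto (fun n : ℕ => n * p n) atTop atTop)
    (hQ : ∀ᶠ n in atTop, Q n = truncLaw fun _ => p n)
    {f : ℕ → ℝ → ℝ} (hf : ∀ n, Measurable (f n)) (hfi : ∀ n, IntegrableOn (f n) (Set.Icc 0 1))
    {ξ : ℝ}
    (hfξ : ∀ ε > 0, ∀ᶠ n : ℕ in atTop, ∀ v ∈ Set.Icc (0 : ℝ) 1,
      |f n v / p n - 1 - ξ / √(n * p n)| ≤ ε * |ξ / √(n * p n)|) :
    (∀ᶠ n in atTop, ∀ v, 0 < truncRatio (f n) (p n) v) ∧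
    TendstoInMeasure μ (fun n ω =>
      ∑ i ∈ Finset.range n, Real.log (truncRatio (f n) (p n) (V n i ω)) -
        (∑ i ∈ Finset.range n, scaledIndicator (ξ / √(n * p n)) (p n) (V n i ω) - ξ ^ 2 / 2))
      atTop (fun _ => 0) := by
  set a : ℕ → ℝ := fun n => ξ / √(n * p n) with ha_def
  have ha : Tendsto a atTop (𝓝 0) :=
    tendsto_const_nhds.div_atTop (Real.tendsto_sqrt_atTop.comp hk)
  have hp2 : ∀ᶠ n in atTop, p n ≤ 1 / 2 :=
    (hp.eventually (gt_mem_nhds (by norm_num : (0 : ℝ) < 1 / 2))).mono fun n h => h.le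
  have hpos : ∀ᶠ n : ℕ in atTop, 0 < n * p n := hk.eventually_gt_atTop 0
  set η : ℕ → ℝ → ℝ := fun n v => truncRatio (f n) (p n) v - 1 with hη_def
  have hηm (n : ℕ) : Measurable (η n) := (measurable_truncRatio (hf n) (p n)).sub_const 1
  -- on `[0,1]`
  have hon : ∀ ε > 0, ∀ᶠ n in atTop, ∀ v ∈ Set.Icc (0 : ℝ) 1, |η n v - a n| ≤ ε * |a n| := by
    intro ε hε
    filter_upwards [hfξ ε hε] with n h v hv
    simp only [hη_def, truncRatio, if_pos hv]
    exact h v hv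
  have hon2 : ∀ᶠ n in atTop, ∀ v ∈ Set.Icc (0 : ℝ) 1, |η n v| ≤ 2 * |a n| := by
    filter_upwards [hon 1 one_pos] with n h v hv
    have := abs_add_le (η n v - a n) (a n)
    rw [sub_add_cancel] at this
    linarith [h v hv]
  -- off `[0,1]`
  have hηoff (n : ℕ) (hn : p n < 1) (v : ℝ) (hv : v ∉ Set.Icc (0 : ℝ) 1) :
      (1 - p n) * η n v = -(p n * ∫ v in Set.Icc (0 : ℝ) 1, η n v) := by
    have e1 : ∫ v in Set.Icc (0 : ℝ) 1, η n v = (∫ v in Set.Icc (0 : ℝ) 1, f n v) / p n - 1 := by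
      have e2 : ∫ v in Set.Icc (0 : ℝ) 1, η n v = ∫ v in Set.Icc (0 : ℝ) 1, (f n v / p n - 1) :=
        setIntegral_congr_fun measurableSet_Icc fun v hv => by
          simp only [hη_def, truncRatio, if_pos hv]
      rw [e2, integral_sub ((hfi n).div_const _) (integrable_const _), integral_div]
      simp
    have h1 : 1 - p n ≠ 0 := by linarith
    have h2 := (hp0 n).ne'
    rw [e1]
    simp only [hη_def]
    rw [truncRatio_of_notMem hv]
    field_simp
    ring
  have hoff : ∀ᶠ n in atTop, ∀ v ∉ Set.Icc (0 : ℝ) 1, |η n v| ≤ 4 * p n * |a n| := by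
    filter_upwards [hon2, hp2] with n h1 h2 v hv
    have h3 := hηoff n (by linarith) v hv
    have h4 := norm_setIntegral_le_of_norm_le_const (μ := volume) (s := Set.Icc (0 : ℝ) 1)
      (f := η n) (C := 2 * |a n|) (by simp) h1
    simp only [Real.norm_eq_abs, Real.volume_real_Icc, sub_zero, max_eq_left zero_le_one,
      mul_one] at h4
    have h5 : (1 - p n) * |η n v| ≤ p n * (2 * |a n|) := by
      have h6 := congrArg abs h3
      rw [abs_mul, abs_neg, abs_mul, abs_of_pos (hp0 n),
        abs_of_nonneg (by linarith : 0 ≤ 1 - p n)] at h6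
      rw [h6]
      exact mul_le_mul_of_nonneg_left h4 (hp0 n).le
    nlinarith [abs_nonneg (η n v)]
  have hs : Tendsto (fun n => 2 * |a n|) atTop (𝓝 0) := by simpa using ha.abs.const_mul 2
  have hηs : ∀ᶠ n in atTop, ∀ v, |η n v| ≤ 2 * |a n| := by
    filter_upwards [hon2, hoff, hp2] with n h1 h2 h3 v
    by_cases hv : v ∈ Set.Icc (0 : ℝ) 1
    · exact h1 v hv
    · refine (h2 v hv).trans ?_
      have := abs_nonneg (a n)
      nlinarith
  have hψs : ∀ᶠ n in atTop, ∀ v, |scaledIndicator (a n) (p n) v| ≤ 2 * |a n| := by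
    filter_upwards [hp2] with n h v
    linarith [abs_scaledIndicator_le (hp0 n).le (by linarith) (a n) v, abs_nonneg (a n)]
  refine ⟨?_, ?_⟩
  · filter_upwards [hηs, hs.eventually (gt_mem_nhds one_pos)] with n h1 h2 v
    have := (abs_le.1 (h1 v)).1
    simp only [hη_def] at this
    linarith
  have hη0 : ∀ᶠ n in atTop, ∫ v, η n v ∂Q n = 0 := by
    filter_upwards [hηs, hp2, hQ] with n h1 h2 h3
    rw [h3, integral_truncLaw_const (hp0 n).le (by linarith) (hηm n) h1,
      hηoff n (by linarith) 2 two_notMem_Icc]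
    ring
  have hψ0 : ∀ᶠ n in atTop, ∫ v, scaledIndicator (a n) (p n) v ∂Q n = 0 := by
    filter_upwards [hp2, hQ] with n h2 h3
    rw [h3, integral_scaledIndicator (hp0 n).le (by linarith)]
  have hψ2 : Tendsto (fun n : ℕ => n * ∫ v, scaledIndicator (a n) (p n) v ^ 2 ∂Q n) atTop
      (𝓝 (ξ ^ 2)) := by
    have ht : Tendsto (fun n => ξ ^ 2 * (1 - p n)) atTop (𝓝 (ξ ^ 2)) := by
      simpa using (hp.const_sub 1).const_mul (ξ ^ 2)
    refine ht.congr' ?_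
    filter_upwards [hp2, hQ, hpos] with n h2 h3 h4
    rw [h3, integral_scaledIndicator_sq (hp0 n).le (by linarith), ← mul_mul_div_sqrt_sq h4 ξ]
    ring
  have hd : Tendsto (fun n : ℕ => n * ∫ v, (η n v - scaledIndicator (a n) (p n) v) ^ 2 ∂Q n)
      atTop (𝓝 0) := by
    -- On [0,1], of null mass p, |η - ψ| ≤ (ε + p)|a|. At the atom, of mass at most 1, |η - ψ| ≤
    -- 4p|a| + p|a|. Multiplying the squares by n and using npa² = ξ² gives the bound.
    have key : ∀ ε > 0, ∀ᶠ n : ℕ in atTop,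
        n * ∫ v, (η n v - scaledIndicator (a n) (p n) v) ^ 2 ∂Q n ≤
          ξ ^ 2 * ((ε + p n) ^ 2 + 25 * p n) := by
      intro ε hε
      filter_upwards [hon ε hε, hoff, hp2, hQ, hpos, hηs, hψs] with n h1 h2 h3 h4 h5 h6 h7
      have hpn := hp0 n
      have hb (v : ℝ) : |(η n v - scaledIndicator (a n) (p n) v) ^ 2| ≤ (4 * |a n|) ^ 2 := by
        rw [abs_pow]
        refine pow_le_pow_left₀ (abs_nonneg _) ((abs_sub _ _).trans ?_) 2
        linarith [h6 v, h7 v]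
      have hdm : Measurable fun v => (η n v - scaledIndicator (a n) (p n) v) ^ 2 :=
        ((hηm n).sub (measurable_scaledIndicator _ _)).pow_const 2
      rw [h4, integral_truncLaw_const hpn.le (by linarith) hdm hb]
      have b1 : ∫ v in Set.Icc (0 : ℝ) 1, (η n v - scaledIndicator (a n) (p n) v) ^ 2 ≤
          ((ε + p n) * |a n|) ^ 2 := by
        have := norm_setIntegral_le_of_norm_le_const (μ := volume) (s := Set.Icc (0 : ℝ) 1)
          (f := fun v => (η n v - scaledIndicator (a n) (p n) v) ^ 2)
          (C := ((ε + p n) * |a n|) ^ 2) (by simp) (fun v hv => by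
            rw [Real.norm_eq_abs, abs_pow]
            refine pow_le_pow_left₀ (abs_nonneg _) ?_ 2
            rw [scaledIndicator, if_pos hv, show η n v - a n * (1 - p n) =
              (η n v - a n) + p n * a n by ring]
            refine (abs_add_le _ _).trans ?_
            rw [abs_mul, abs_of_pos hpn]
            linarith [h1 v hv])
        simp only [Real.norm_eq_abs, Real.volume_real_Icc, sub_zero, max_eq_left zero_le_one,
          mul_one] at this
        exact (le_abs_self _).trans this
      have b2 : (η n 2 - scaledIndicator (a n) (p n) 2) ^ 2 ≤ (5 * p n * |a n|) ^ 2 := by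
        rw [← sq_abs (η n 2 - _)]
        refine pow_le_pow_left₀ (abs_nonneg _) ?_ 2
        rw [scaledIndicator, if_neg two_notMem_Icc, sub_neg_eq_add]
        refine (abs_add_le _ _).trans ?_
        rw [abs_mul, abs_of_pos hpn]
        linarith [h2 2 two_notMem_Icc]
      have hka := mul_mul_div_sqrt_sq h5 ξ
      rw [← hka]
      change _ ≤ n * p n * a n ^ 2 * _
      have b3 : (1 - p n) * (η n 2 - scaledIndicator (a n) (p n) 2) ^ 2 ≤
          (5 * p n * |a n|) ^ 2 :=
        (mul_le_of_le_one_left (sq_nonneg _) (by linarith)).trans b2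
      have b4 := mul_le_mul_of_nonneg_left b1 hpn.le
      have b5 := mul_le_mul_of_nonneg_left (add_le_add b4 b3) (Nat.cast_nonneg (α := ℝ) n)
      refine b5.trans_eq ?_
      rw [mul_pow, mul_pow _ |a n|, sq_abs]
      ring
    rw [Metric.tendsto_atTop']
    intro δ hδ
    set ε := min 1 (δ / (2 * (ξ ^ 2 + 1))) with hε_def
    have hε : 0 < ε := by positivity
    have ht : Tendsto (fun n => ξ ^ 2 * ((ε + p n) ^ 2 + 25 * p n)) atTop
        (𝓝 (ξ ^ 2 * ((ε + 0) ^ 2 + 25 * 0))) :=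
      (((hp.const_add ε).pow 2).add (hp.const_mul 25)).const_mul _
    have hlt : ξ ^ 2 * ((ε + 0) ^ 2 + 25 * 0) < δ := by
      have h1 : ε ≤ 1 := min_le_left _ _
      have h2 : ε ≤ δ / (2 * (ξ ^ 2 + 1)) := min_le_right _ _
      rw [le_div_iff₀ (by positivity)] at h2
      have h3 : ε ^ 2 ≤ ε := by nlinarith
      have h4 : ξ ^ 2 * ε ^ 2 ≤ ξ ^ 2 * ε := mul_le_mul_of_nonneg_left h3 (sq_nonneg _)
      nlinarith
    obtain ⟨N, hN⟩ := eventually_atTop.1 ((key ε hε).and (ht.eventually (gt_mem_nhds hlt)))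
    refine ⟨N, fun n hn => ?_⟩
    obtain ⟨g1, g2⟩ := hN n hn.le
    rw [Real.dist_eq, sub_zero, abs_of_nonneg]
    · linarith
    · exact mul_nonneg n.cast_nonneg (integral_nonneg fun _ => sq_nonneg _)
  have := tendstoInMeasure_sum_log_one_add hV hind hVQ hηm
    (fun n => measurable_scaledIndicator (a n) (p n)) hs hηs hψs hη0 hψ0 hd hψ2
  simpa only [hη_def, ha_def, add_sub_cancel] using this

/-! ### Passage to the number of exceedances and assembly. -/

section Exceedances

variable {Ω : Type*} {X : ℕ → Ω → I → ℝ}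

/-- Nonnegativity makes membership in [0,1] the same as being at most 1, so the indicators add up to
the count. -/
lemma sum_scaledIndicator_truncUnit {n : ℕ} {c : ℝ} {ω : Ω}
    (hnn : ∀ i, 0 ≤ supRatio c (X i ω)) (a p : ℝ) :
    ∑ i ∈ Finset.range n, scaledIndicator a p (truncUnit (supRatio c (X i ω))) =
      a * (numExceed X n c ω - n * p) := by
  classical
  have e (i : ℕ) : scaledIndicator a p (truncUnit (supRatio c (X i ω))) =
      a * ((if supRatio c (X i ω) ≤ 1 then 1 else 0) - p) := by
    by_cases h : supRatio c (X i ω) ≤ 1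
    · rw [scaledIndicator, if_pos (truncUnit_mem_iff.2 ⟨hnn i, h⟩), if_pos h]
    · rw [scaledIndicator, if_neg fun hh => h (truncUnit_mem_iff.1 hh).2, if_neg h]
      ring
  simp_rw [e]
  rw [← Finset.mul_sum, Finset.sum_sub_distrib, Finset.sum_boole]
  simp only [Finset.sum_const, Finset.card_range, nsmul_eq_mul]
  congr 3

lemma pointProcess_eq_truncUnit (n : ℕ) (c : ℝ) (ω : Ω) :
    pointProcess X n c ω = ∑ i ∈ Finset.range n,
      (Measure.dirac (truncUnit (supRatio c (X i ω)))).restrict (Set.Icc 0 1) := by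
  simp_rw [pointProcess, dirac_truncUnit_restrict]

end Exceedances

lemma tendsto_altParam {T : ℝ → ℝ} {C A ξ : ℝ} {c : ℕ → ℝ}
    (hc_inf : Tendsto (fun n : ℕ => (n : ℝ) * |c n|) atTop atTop) :
    Tendsto (altParam T C A ξ c) atTop (𝓝 0) := by
  have h : Tendsto (fun n : ℕ => √(n * |c n|)) atTop atTop :=
    Real.tendsto_sqrt_atTop.comp hc_inf
  have h2 : Tendsto (fun n : ℕ => ξ / √A / (C - ∫ u in Set.Icc (0 : ℝ) 1, T u) / √(n * |c n|))
      atTop (𝓝 0) := tendsto_const_nhds.div_atTop h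
  refine h2.congr fun n => ?_
  rw [altParam, div_div, div_div]
  congr 1
  ring

/-- The local parameter is scaled so that the first-order change of the density at the origin is
exactly a = ξ/√(np). -/
lemma altParam_mul {T : ℝ → ℝ} {C A ξ : ℝ} (hC : C ≠ ∫ u in Set.Icc (0 : ℝ) 1, T u)
    (c : ℕ → ℝ) (n : ℕ) :
    altParam T C A ξ c n * (C - ∫ u in Set.Icc (0 : ℝ) 1, T u) = ξ / √(n * (|c n| * A)) := by
  have h := sub_ne_zero.2 hC
  rw [altParam, ← mul_assoc (n : ℝ), Real.sqrt_mul (by positivity : (0 : ℝ) ≤ n * |c n|) A, div_mul_eq_mul_div,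
    mul_div_mul_right _ _ h]

/-- The theorem for `T` measurable and bounded on the whole line and right continuous at `0`. -/
theorem loglikelihood_expansion_of_measurable {Ω : Type*} [MeasurableSpace Ω]
    {T : ℝ → ℝ} {C M K : ℝ} {P : ℝ → Measure Ω} [∀ ϑ, IsProbabilityMeasure (P ϑ)]
    {W : Ω → ℝ} {Z : Ω → I → ℝ} {X : ℕ → Ω → I → ℝ}
    (hT : Measurable T) (hK : ∀ u, |T u| ≤ K) (hlim : Tendsto T (𝓝[≥] 0) (𝓝 C))
    (hC : C ≠ ∫ u in Set.Icc (0 : ℝ) 1, T u) (hM : M < 0)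
    (hmodel : IsExpModel T M P W Z X) (hA : 0 < meanInf (P 0) Z)
    {c : ℕ → ℝ} (hc_neg : ∀ n, c n < 0) (hc_zero : Tendsto (fun n => |c n|) atTop (𝓝 0))
    (hc_inf : Tendsto (fun n : ℕ => (n : ℝ) * |c n|) atTop atTop) (ξ : ℝ) :
    (∀ᶠ n in atTop,
      lawN P X n (c n) (altParam T C (meanInf (P 0) Z) ξ c n) ≪ lawN P X n (c n) 0 ∧
      lawN P X n (c n) 0 ≪ lawN P X n (c n) (altParam T C (meanInf (P 0) Z) ξ c n)) ∧
    TendstoInMeasure (P 0)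
      (fun n ω => logLik P X n (c n) (altParam T C (meanInf (P 0) Z) ξ c n) ω -
        (ξ * stdNumExceed X (meanInf (P 0) Z) n (c n) ω - ξ ^ 2 / 2))
      atTop (fun _ => 0) ∧
    TendstoInDistribution (fun n ω => stdNumExceed X (meanInf (P 0) Z) n (c n) ω)
      atTop (id : ℝ → ℝ) (fun _ => P 0) (gaussianReal 0 1) := by
  set A := meanInf (P 0) Z with hA_def
  set ν := (P 0).map fun ω => ⨅ t, Z ω t with hν
  have hY := hmodel.measurable_iInf
  have hνp : IsProbabilityMeasure ν := Measure.isProbabilityMeasure_map hY.aemeasurable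
  have hνA : ∫ y, y ∂ν = A := by
    rw [hν, integral_map (f := fun y => y) hY.aemeasurable
      measurable_id.aestronglyMeasurable]
    rfl
  obtain ⟨m, hm1, hm⟩ := hmodel.exists_bound_iInf
  set ϑ := altParam T C A ξ c with hϑ
  have hϑ0 : Tendsto ϑ atTop (𝓝 0) := tendsto_altParam hc_inf
  set p : ℕ → ℝ := fun n => |c n| * A with hp_def
  have hp0 (n : ℕ) : 0 < p n := mul_pos (abs_pos.2 (hc_neg n).ne) hA
  have hp : Tendsto p atTop (𝓝 0) := by simpa using hc_zero.mul_const A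
  have hk : Tendsto (fun n : ℕ => n * p n) atTop atTop := by
    simp_rw [hp_def, ← mul_assoc]
    exact hc_inf.atTop_mul_const hA
  have hp1 : ∀ᶠ n in atTop, p n < 1 := hp.eventually (gt_mem_nhds one_pos)
  have hcm0 : Tendsto (fun n => |c n| * m) atTop (𝓝 0) := by simpa using hc_zero.mul_const m
  have hcm : ∀ᶠ n in atTop, |c n| * m ≤ 1 :=
    (hcm0.eventually (gt_mem_nhds one_pos)).mono fun n h => h.le
  have hMc : ∀ᶠ n in atTop, M < c n := by
    filter_upwards [hc_zero.eventually (gt_mem_nhds (neg_pos.2 hM))] with n h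
    rw [abs_of_neg (hc_neg n)] at h
    linarith
  -- the truncated observations
  set V : ℕ → ℕ → Ω → ℝ := fun n i ω => truncUnit (countSup (c n) (X i ω)) with hV_def
  have hφ (n : ℕ) : Measurable fun x : I → ℝ => truncUnit (countSup (c n) x) :=
    measurable_truncUnit.comp (measurable_countSup (c n))
  have hV (n i : ℕ) : Measurable (V n i) := (hφ n).comp (hmodel.measurable_X i)
  have hind (n : ℕ) (θ : ℝ) : iIndepFun (V n) (P θ) := (hmodel.indep θ).comp _ fun _ => hφ n
  set Q : ℕ → Measure ℝ := fun n => (P 0).map (V n 0) with hQ_def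
  have hQp (n : ℕ) : IsProbabilityMeasure (Q n) :=
    Measure.isProbabilityMeasure_map (hV n 0).aemeasurable
  have hVQ (n i : ℕ) : (P 0).map (V n i) = Q n :=
    (((hmodel.copies 0 i).trans (hmodel.copies 0 0).symm).comp (hφ n)).map_eq
  set f : ℕ → ℝ → ℝ := fun n => ratioDensity (expDensity T (ϑ n)) ν (c n) with hf_def
  have hf (n : ℕ) : Measurable (f n) :=
    measurable_ratioDensity (measurable_expDensity hT _) ν (c n)
  have hfi (n : ℕ) : IntegrableOn (f n) (Set.Icc 0 1) := by
    obtain ⟨B, hB⟩ := exists_abs_expDensity_le hT hK (ϑ n)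
    exact integrableOn_ratioDensity (measurable_expDensity hT _) hB hm (c n)
  have hQ : ∀ᶠ n in atTop, Q n = truncLaw fun _ => p n := by
    filter_upwards [hcm, hMc] with n h1 h2
    have h3 : expDensity T 0 = fun _ => 1 := funext (expDensity_zero T)
    have := hmodel.map_truncUnit_countSup hT hK hM (hc_neg n) h2 hm h1 0 0
    rw [h3, ratioDensity_one, ← hν, hνA] at this
    exact this
  have hfξ : ∀ ε > 0, ∀ᶠ n : ℕ in atTop, ∀ v ∈ Set.Icc (0 : ℝ) 1,
      |f n v / p n - 1 - ξ / √(n * p n)| ≤ ε * |ξ / √(n * p n)| := by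
    intro ε hε
    have hΔ := sub_ne_zero.2 hC
    have hΔ' := abs_pos.2 hΔ
    -- The expansion error is relative to |ϑ|, while the error wanted is relative to |ϑ(C - ∫T)|;
    -- hence the tolerance ε|C - ∫T|.
    obtain ⟨δ, hδ, hexp⟩ := exists_abs_expDensity_sub_le hT hK hlim (mul_pos hε hΔ')
    have hϑδ : ∀ᶠ n in atTop, |ϑ n| ≤ δ := by
      have : Tendsto (fun n => |ϑ n|) atTop (𝓝 0) := by simpa using hϑ0.abs
      exact (this.eventually (gt_mem_nhds hδ)).mono fun n h => h.le
    have hcδ : ∀ᶠ n in atTop, |c n| * m ≤ δ :=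
      (hcm0.eventually (gt_mem_nhds hδ)).mono fun n h => h.le
    filter_upwards [hϑδ, hcδ] with n h1 h2 v hv
    obtain ⟨B, hB⟩ := exists_abs_expDensity_le hT hK (ϑ n)
    have h3 := abs_ratioDensity_sub_le (measurable_expDensity hT (ϑ n)) hB hm h2
      (hexp (ϑ n) h1) hv
    rw [← hν, hνA, altParam_mul hC] at h3
    change |f n v - p n * (1 + ξ / √(n * p n))| ≤ p n * _ at h3
    have h4 : ξ / √(n * p n) = ϑ n * (C - ∫ u in Set.Icc (0 : ℝ) 1, T u) :=
      (altParam_mul hC c n).symm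
    have hpn := hp0 n
    have e : f n v / p n - 1 - ξ / √(n * p n) = (f n v - p n * (1 + ξ / √(n * p n))) / p n := by
      rw [sub_div, mul_div_cancel_left₀ _ hpn.ne']
      ring
    rw [e, abs_div, abs_of_pos hpn, div_le_iff₀ hpn]
    refine h3.trans_eq ?_
    rw [h4, abs_mul]
    ring
  obtain ⟨hpos, hLAN⟩ := tendstoInMeasure_sum_log_truncRatio hV (fun n => hind n 0) hVQ hp0 hp hk
    hQ hf hfi hfξ
  -- almost sure identities
  have hsup (n : ℕ) (θ : ℝ) : ∀ᵐ ω ∂P θ, ∀ i, V n i ω = truncUnit (supRatio (c n) (X i ω)) := by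
    filter_upwards [hmodel.ae_countSup_eq (c n) θ] with ω h i
    simp only [hV_def, h i]
  have hnn (n : ℕ) : ∀ᵐ ω ∂P 0, ∀ i, 0 ≤ supRatio (c n) (X i ω) := by
    have := ae_all_iff.2 fun i => hmodel.ae_countSup_nonneg hM (hc_neg n) 0 i
    filter_upwards [this, hmodel.ae_countSup_eq (c n) 0] with ω h1 h2 i
    rw [← h2 i]; exact h1 i
  -- Used with a = ξ for the expansion and with a = 1 for the limit law, the latter covering ξ = 0
  -- as well.
  have hsum (n : ℕ) (a : ℝ) : ∀ᵐ ω ∂P 0,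
      ∑ i ∈ Finset.range n, scaledIndicator (a / √(n * p n)) (p n) (V n i ω) =
        a * stdNumExceed X A n (c n) ω := by
    filter_upwards [hsup n 0, hnn n] with ω h1 h2
    simp_rw [h1]
    rw [sum_scaledIndicator_truncUnit h2, stdNumExceed, hp_def]
    simp only [mul_assoc]
    ring
  have hN (n : ℕ) (θ : ℝ) : pointProcess X n (c n) =ᵐ[P θ] fun ω =>
      ∑ i ∈ Finset.range n, (Measure.dirac (V n i ω)).restrict (Set.Icc 0 1) := by
    filter_upwards [hsup n θ] with ω h
    rw [pointProcess_eq_truncUnit]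
    simp_rw [h]
  have hlik : ∀ᶠ n in atTop,
      (lawN P X n (c n) (ϑ n) ≪ lawN P X n (c n) 0 ∧
        lawN P X n (c n) 0 ≪ lawN P X n (c n) (ϑ n)) ∧
      ∀ᵐ ω ∂P 0, logLik P X n (c n) (ϑ n) ω =
        ∑ i ∈ Finset.range n, Real.log (truncRatio (f n) (p n) (V n i ω)) := by
    filter_upwards [hpos, hQ, hp1, hcm, hMc] with n h1 h2 h3 h4 h5
    have hVϑ (i : ℕ) : (P (ϑ n)).map (V n i) =
        (Q n).withDensity fun v => ENNReal.ofReal (truncRatio (f n) (p n) v) := by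
      rw [h2, ← truncLaw_eq_withDensity (hf n) (hp0 n) h3]
      exact hmodel.map_truncUnit_countSup hT hK hM (hc_neg n) h5 hm h4 (ϑ n) i
    exact absolutelyContinuous_and_log_rnDeriv_pointProcess (hV n) (hind n 0) (hind n (ϑ n))
      (measurable_truncRatio (hf n) (p n)) h1 (fun v hv => truncRatio_of_notMem hv) (hVQ n) hVϑ
      (hN n 0) (hN n (ϑ n))
  refine ⟨hlik.mono fun n h => h.1, ?_, ?_⟩
  · refine hLAN.congr' ?_ (by rfl)
    filter_upwards [hlik] with n h
    filter_upwards [h.2, hsum n ξ] with ω h1 h2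
    rw [h1, h2]
  · have hmeas (n : ℕ) : Measurable fun ω =>
        ∑ i ∈ Finset.range n, scaledIndicator (1 / √(n * p n)) (p n) (V n i ω) :=
      Finset.measurable_sum _ fun i _ => (measurable_scaledIndicator _ _).comp (hV n i)
    have hae (n : ℕ) : (fun ω => stdNumExceed X A n (c n) ω) =ᵐ[P 0] fun ω =>
        ∑ i ∈ Finset.range n, scaledIndicator (1 / √(n * p n)) (p n) (V n i ω) := by
      filter_upwards [hsum n 1] with ω h
      rw [h, one_mul]
    refine ⟨fun n => ⟨_, hmeas n, hae n⟩, aemeasurable_id, ?_⟩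
    refine ProbabilityMeasure.tendsto_iff_tendsto_charFun.2 fun t => ?_
    have ha : Tendsto (fun n : ℕ => |1 / √(n * p n)|) atTop (𝓝 0) := by
      have : Tendsto (fun n : ℕ => 1 / √(n * p n)) atTop (𝓝 0) :=
        tendsto_const_nhds.div_atTop (Real.tendsto_sqrt_atTop.comp hk)
      simpa using this.abs
    have hcf := tendsto_charFun_sum_of_bound hV (fun n => hind n 0) hVQ
      (fun n => measurable_scaledIndicator (1 / √(n * p n)) (p n)) ha
      (hp1.mono fun n h => abs_scaledIndicator_le (hp0 n).le h.le _) (by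
        filter_upwards [hp1, hQ] with n h1 h2
        rw [h2, integral_scaledIndicator (hp0 n).le h1.le]) (by
        have ht : Tendsto (fun n => 1 - p n) atTop (𝓝 1) := by simpa using hp.const_sub 1
        refine ht.congr' ?_
        filter_upwards [hp1, hQ, hk.eventually_gt_atTop 0] with n h1 h2 h3
        rw [h2, integral_scaledIndicator_sq (hp0 n).le h1.le]
        have := mul_mul_div_sqrt_sq h3 1
        rw [one_pow] at this
        rw [← mul_assoc, ← mul_assoc, mul_right_comm (n : ℝ), this, one_mul]) t
    have hg : charFun ((gaussianReal 0 1).map (id : ℝ → ℝ)) t = Complex.exp (-t ^ 2 / 2) := by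
      rw [Measure.map_id, charFun_gaussianReal]
      congr 1
      simp
      ring
    simp only [ProbabilityMeasure.coe_mk]
    rw [hg]
    refine hcf.congr fun n => ?_
    rw [Measure.map_congr (hae n)]

/-! ### Reduction to T defined and regular on the whole line. -/

/-- The extension of a function on `(0,1]` to the line by a constant. -/
def extendConst (T : ℝ → ℝ) (C : ℝ) : ℝ → ℝ :=
  open Classical in fun u => if u ∈ Set.Ioc (0 : ℝ) 1 then T u else C

section ExtendConst

variable {T : ℝ → ℝ} {C : ℝ}

lemma extendConst_of_mem {u : ℝ} (hu : u ∈ Set.Ioc (0 : ℝ) 1) : extendConst T C u = T u := if_pos hu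

lemma extendConst_of_notMem {u : ℝ} (hu : u ∉ Set.Ioc (0 : ℝ) 1) : extendConst T C u = C :=
  if_neg hu

lemma measurable_extendConst (hT : Measurable ((Set.Icc (0 : ℝ) 1).domRestrict T)) :
    Measurable (extendConst T C) := by
  refine measurable_of_restrict_of_restrict_compl (s := Set.Ioc (0 : ℝ) 1) measurableSet_Ioc ?_ ?_
  · have e : (Set.Ioc (0 : ℝ) 1).domRestrict (extendConst T C) =
        (Set.Icc (0 : ℝ) 1).domRestrict T ∘ Set.inclusion Set.Ioc_subset_Icc_self :=
      funext fun u => extendConst_of_mem u.2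
    rw [e]
    exact hT.comp (measurable_inclusion _)
  · have e : (Set.Ioc (0 : ℝ) 1)ᶜ.domRestrict (extendConst T C) = fun _ => C :=
      funext fun u => extendConst_of_notMem u.2
    rw [e]
    exact measurable_const

/-- Assigning the value C at 0 turns the one-sided limit into right continuity, which the expansion
needs because its range of u includes 0. -/
lemma tendsto_extendConst (hlim : Tendsto T (𝓝[>] 0) (𝓝 C)) :
    Tendsto (extendConst T C) (𝓝[≥] 0) (𝓝 C) := by
  have h0 : extendConst T C 0 = C := extendConst_of_notMem (by simp)
  have h : ContinuousWithinAt (extendConst T C) (Set.Ioi 0) 0 := by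
    rw [ContinuousWithinAt, h0]
    refine hlim.congr' ?_
    filter_upwards [Ioc_mem_nhdsGT (zero_lt_one' ℝ)] with u hu using (extendConst_of_mem hu).symm
  have h' := continuousWithinAt_Ioi_iff_Ici.1 h
  rwa [ContinuousWithinAt, h0] at h'

lemma setIntegral_comp_extendConst (g : ℝ → ℝ) :
    ∫ u in Set.Icc (0 : ℝ) 1, g (extendConst T C u) = ∫ u in Set.Icc (0 : ℝ) 1, g (T u) := by
  rw [integral_Icc_eq_integral_Ioc, integral_Icc_eq_integral_Ioc]
  exact setIntegral_congr_fun measurableSet_Ioc fun u hu => by rw [extendConst_of_mem hu]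

lemma expFamily_extendConst (ϑ : ℝ) : expFamily (extendConst T C) ϑ = expFamily T ϑ := by
  unfold expFamily
  rw [← restrict_Ioc_eq_restrict_Icc]
  refine withDensity_congr_ae ?_
  filter_upwards [ae_restrict_mem measurableSet_Ioc] with u hu
  rw [expDensity, expDensity, normConst, normConst,
    setIntegral_comp_extendConst fun x => Real.exp (ϑ * x), extendConst_of_mem hu]

end ExtendConst

end GPPTesting

end

theorem theorem3p2 {Ω : Type*} [MeasurableSpace Ω]
    (T : ℝ → ℝ) (C M : ℝ) (P : ℝ → Measure Ω) [∀ ϑ, IsProbabilityMeasure (P ϑ)]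
    (W : Ω → ℝ) (Z : Ω → unitInterval → ℝ) (X : ℕ → Ω → unitInterval → ℝ)
    (hT_meas : Measurable ((Set.Icc (0 : ℝ) 1).domRestrict T))
    (hT_bdd : ∃ K : ℝ, ∀ u ∈ Set.Icc (0 : ℝ) 1, |T u| ≤ K)
    (hT_lim : Tendsto T (𝓝[>] 0) (𝓝 C))
    (hC : C ≠ ∫ u in Set.Icc (0 : ℝ) 1, T u)
    (hM : M < 0)
    (hmodel : GPPTesting.IsExpModel T M P W Z X)
    (hA : 0 < GPPTesting.meanInf (P 0) Z)
    (c : ℕ → ℝ) (hc_neg : ∀ n, c n < 0)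
    (hc_zero : Tendsto (fun n => |c n|) atTop (𝓝 0))
    (hc_inf : Tendsto (fun n : ℕ => (n : ℝ) * |c n|) atTop atTop)
    (ξ : ℝ) :
    -- eventually the two laws of the point process are mutually absolutely continuous
    (∀ᶠ n in atTop,
      GPPTesting.lawN P X n (c n) (GPPTesting.altParam T C (GPPTesting.meanInf (P 0) Z) ξ c n) ≪
        GPPTesting.lawN P X n (c n) 0 ∧
      GPPTesting.lawN P X n (c n) 0 ≪
        GPPTesting.lawN P X n (c n)
          (GPPTesting.altParam T C (GPPTesting.meanInf (P 0) Z) ξ c n)) ∧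
    -- the loglikelihood ratio is `ξ Z_{n1} - ξ²/2 + o_{P_0}(1)`
    TendstoInMeasure (P 0)
      (fun n ω =>
        GPPTesting.logLik P X n (c n)
            (GPPTesting.altParam T C (GPPTesting.meanInf (P 0) Z) ξ c n) ω -
          (ξ * GPPTesting.stdNumExceed X (GPPTesting.meanInf (P 0) Z) n (c n) ω - ξ ^ 2 / 2))
      atTop (fun _ => 0) ∧
    -- `Z_{n1}` is asymptotically standard normal under `P_0`
    TendstoInDistribution
      (fun n ω => GPPTesting.stdNumExceed X (GPPTesting.meanInf (P 0) Z) n (c n) ω)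
      atTop (id : ℝ → ℝ) (fun _ => P 0) (gaussianReal 0 1) := by
  obtain ⟨K, hK⟩ := hT_bdd
  have hint : ∫ u in Set.Icc (0 : ℝ) 1, GPPTesting.extendConst T C u =
      ∫ u in Set.Icc (0 : ℝ) 1, T u := GPPTesting.setIntegral_comp_extendConst fun x => x
  have hbdd (u : ℝ) : |GPPTesting.extendConst T C u| ≤ max K |C| := by
    by_cases hu : u ∈ Set.Ioc (0 : ℝ) 1
    · rw [GPPTesting.extendConst_of_mem hu]
      exact (hK u (Set.Ioc_subset_Icc_self hu)).trans (le_max_left _ _)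
    · rw [GPPTesting.extendConst_of_notMem hu]
      exact le_max_right _ _
  -- T enters the model only through the law of W, which is unaffected by changing T at 0 or outside
  -- [0,1].
  have hmodel' : GPPTesting.IsExpModel (GPPTesting.extendConst T C) M P W Z X :=
    { hmodel with
      law_W := fun ϑ => by rw [hmodel.law_W, GPPTesting.expFamily_extendConst] }
  have halt : GPPTesting.altParam (GPPTesting.extendConst T C) C
      (GPPTesting.meanInf (P 0) Z) ξ c =
      GPPTesting.altParam T C (GPPTesting.meanInf (P 0) Z) ξ c := by
    funext n
    rw [GPPTesting.altParam, GPPTesting.altParam, hint]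
  have h := GPPTesting.loglikelihood_expansion_of_measurable
    (GPPTesting.measurable_extendConst hT_meas) hbdd (GPPTesting.tendsto_extendConst hT_lim)
    (by rwa [hint]) hM hmodel' hA hc_neg hc_zero hc_inf ξ
  rwa [halt] at h
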